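/- Let $\Theta\subseteq\mathbb R^p$ be a (measurable) parameter space, $\{P_\theta:\theta\in\Theta\}$ a statistical model on a sample space $\mathcal X$, and let $X_1,X_2,\dots$ be i.i.d. from $P_{\theta^*}$, where $\theta^*$ lies in the interior of $\Theta$; write $P_0$ for the law of $(X_1,\dots,X_n)$. Let $\rho:\mathcal X\times\Theta\to[0,\infty)$ be a loss with score $\psi=\partial\rho/\partial\theta$ (with any convention at points where $\rho(x,\cdot)$ is not differentiable), and let $\pi$ be a prior probability density on $\Theta$. For weights $\boldsymbol\alpha=(\alpha_i)_{i\ge1}$ put $\overline\alpha_n=\frac1n\sum_{i\le n}\alpha_i$, let $\hat\theta^{\boldsymbol\alpha}_\rho$ (depending on $n$, measurable in the data and the weights) be a solution of $\frac1n\sum_{i\le n}\alpha_i\psi(X_i,\hat\theta^{\boldsymbol\alpha}_\rho)=0$ whenever this equation has a solution in $\Theta$, and let the weighted M-posterior $\pi^\rho_n(\cdot\mid F_n^{\boldsymbol\alpha})$ be the distribution on $\Theta$ with density $$\pi^\rho_n(\theta\mid F_n^{\boldsymbol\alpha})=\frac{\exp\big(-\sum_{i\le n}\alpha_i\rho(X_i,\theta)\big)\pi(\theta)}{\int_\Theta\exp\big(-\sum_{i\le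 n}\alpha_i\rho(X_i,\theta')\big)\pi(\theta')\,d\theta'} .$$ Let $\pi_\alpha$ be a probability distribution on $(0,\infty)$ with finite second moment. Suppose that: (1) $\pi$ is continuous and positive on a neighbourhood of $\theta^*$. (2) (Weighted M-LAN) There is a positive definite matrix $V_{\theta^*}$ such that for every sequence $\boldsymbol\alpha$ of positive weights with $\limsup_n\frac1n\sum_{i\le n}\alpha_i^2<\infty$ and every compact $K\subset\mathbb R^p$, $\sup_{h\in K}|R_{n,\boldsymbol\alpha}(h)|\to0$ in $P_0$-probability, where $$R_{n,\boldsymbol\alpha}(h)=\sum_{i=1}^n\alpha_i\Big(\rho(X_i,\theta^*)-\rho\big(X_i,\theta^*+\tfrac{h}{\sqrt n}\big)\Big)-h^\top\overline\alpha_nV_{\theta^*}\sqrt n\,(\hat\theta^{\boldsymbol\alpha}_\rho-\theta^*)+\tfrac12h^\top\overline\alpha_nV_{\theta^*}h .$$ (3) (Concentration) For $\pi_\alpha^{\otimes\mathbb N}$-almost every weight sequence $\boldsymbol\alpha$ and every sequence $r_n\to\infty$, $$\mathbb E_{P_0}\Big[\int_\Theta\mathbf 1\{\|\sqrt n(\theta-\theta^*)\|>r_n\}\,\pi^\rho_n(\theta\mid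 F_n^{\boldsymbol\alpha})\,d\theta\Big]\to0 .$$ Let the weights $\alpha_i$ be drawn i.i.d. from $\pi_\alpha$, independently of the data. Then $$d_{\mathrm{TV}}\Big(\pi^\rho_n(\cdot\mid F_n^{\boldsymbol\alpha}),\;N\big(\hat\theta^{\boldsymbol\alpha}_\rho,\;V_{\theta^*}^{-1}/(\overline\alpha_n n)\big)\Big)\to0\qquad\text{in }P_0\times\pi_\alpha^{(n)}\text{-probability},$$ where $\pi_\alpha^{(n)}$ is the law of $(\alpha_1,\dots,\alpha_n)$ and $d_{\mathrm{TV}}$ is the total variation distance. -/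

import Mathlib

open MeasureTheory ProbabilityTheory Filter Topology Matrix
open scoped ENNReal

noncomputable section

namespace MPosterior

variable {p : ℕ} {𝒳 : Type*}

/-- `d_TV(μ, ν) = sup_A |μ(A) - ν(A)|`, the supremum over all measurable sets `A`. -/
def dTV {E : Type*} [MeasurableSpace E] (μ ν : Measure E) : ℝ≥0∞ :=
  ⨆ (A : Set E) (_ : MeasurableSet A), ENNReal.ofReal |μ.real A - ν.real A|

/-- `Y n → 0` in probability, where `Y n` is defined on the `n`-th of a sequence of
probability spaces. -/
def TendstoZeroInProb {Ω : ℕ → Type*} [∀ n, MeasurableSpace (Ω n)] (μ : ∀ n, Measure (Ω n))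
    (Y : ∀ n, Ω n → ℝ≥0∞) : Prop :=
  ∀ ε : ℝ≥0∞, 0 < ε → Tendsto (fun n => μ n {ω | ε ≤ Y n ω}) atTop (𝓝 0)

/-- The law of `n` i.i.d. draws from `μ`. -/
def iidLaw {Z : Type*} [MeasurableSpace Z] (μ : Measure Z) (n : ℕ) : Measure (Fin n → Z) :=
  Measure.pi fun _ => μ

/-- The first `n` terms of a sequence. -/
def firstTerms {Z : Type*} (z : ℕ → Z) (n : ℕ) : Fin n → Z := fun i => z i

/-- The average weight. -/
def avgWeight {n : ℕ} (a : Fin n → ℝ) : ℝ := (n : ℝ)⁻¹ * ∑ i, a i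

/-- The integral of `g` against the weighted empirical measure `n⁻¹ ∑ aᵢ δ_{xᵢ}`. -/
def empiricalMean {F : Type*} [AddCommGroup F] [Module ℝ F] {n : ℕ} (a : Fin n → ℝ)
    (x : Fin n → 𝒳) (g : 𝒳 → F) : F :=
  (n : ℝ)⁻¹ • ∑ i, a i • g (x i)

/-- The unnormalized density of the weighted M-posterior. -/
def posteriorWeight (ρ : 𝒳 → EuclideanSpace ℝ (Fin p) → ℝ) (prior : EuclideanSpace ℝ (Fin p) → ℝ)
    {n : ℕ} (a : Fin n → ℝ) (x : Fin n → 𝒳) (θ : EuclideanSpace ℝ (Fin p)) : ℝ :=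
  Real.exp (-((n : ℝ) * empiricalMean a x (fun y => ρ y θ))) * prior θ

/-- The weighted M-posterior, a measure carried by the parameter space `Θ`. -/
def posterior (Θ : Set (EuclideanSpace ℝ (Fin p))) (ρ : 𝒳 → EuclideanSpace ℝ (Fin p) → ℝ)
    (prior : EuclideanSpace ℝ (Fin p) → ℝ) {n : ℕ} (a : Fin n → ℝ) (x : Fin n → 𝒳) :
    Measure (EuclideanSpace ℝ (Fin p)) :=
  (volume.restrict Θ).withDensity fun θ =>
    ENNReal.ofReal (posteriorWeight ρ prior a x θ / ∫ θ' in Θ, posteriorWeight ρ prior a x θ')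

/-- `ψ` is a score function of the loss `ρ`: it is the gradient of `ρ` in the parameter wherever
that gradient exists (values at the kinks of a nonsmooth loss are a free convention). -/
def IsScore (Θ : Set (EuclideanSpace ℝ (Fin p))) (ρ : 𝒳 → EuclideanSpace ℝ (Fin p) → ℝ)
    (ψ : 𝒳 → EuclideanSpace ℝ (Fin p) → EuclideanSpace ℝ (Fin p)) : Prop :=
  ∀ x, ∀ θ ∈ interior Θ, ∀ g, HasGradientAt (ρ x) g θ → ψ x θ = g

/-- `θhat` is a weighted M-estimator: for positive weights it solves the weighted estimating
equation whenever that equation is solvable in `Θ`. -/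
def IsWeightedMEstimator (Θ : Set (EuclideanSpace ℝ (Fin p)))
    (ψ : 𝒳 → EuclideanSpace ℝ (Fin p) → EuclideanSpace ℝ (Fin p))
    (θhat : ∀ n : ℕ, (Fin n → ℝ) → (Fin n → 𝒳) → EuclideanSpace ℝ (Fin p)) : Prop :=
  ∀ (n : ℕ) (a : Fin n → ℝ) (x : Fin n → 𝒳), (∀ i, 0 < a i) →
    (∃ θ ∈ Θ, empiricalMean a x (fun y => ψ y θ) = 0) →
      θhat n a x ∈ Θ ∧ empiricalMean a x (fun y => ψ y (θhat n a x)) = 0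

/-- A weight sequence has finite second moment: `limsup n⁻¹ ∑_{i ≤ n} αᵢ² < ∞`. -/
def FiniteSecondMoment (α : ℕ → ℝ) : Prop :=
  limsup (fun n : ℕ => ENNReal.ofReal ((n : ℝ)⁻¹ * ∑ i ∈ Finset.range n, α i ^ 2)) atTop < ⊤

/-- The remainder `R_{n,α}(h)` of the weighted M-LAN expansion. -/
def lanRemainder (ρ : 𝒳 → EuclideanSpace ℝ (Fin p) → ℝ)
    (θhat : ∀ n : ℕ, (Fin n → ℝ) → (Fin n → 𝒳) → EuclideanSpace ℝ (Fin p))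
    (θs : EuclideanSpace ℝ (Fin p)) (V : Matrix (Fin p) (Fin p) ℝ) {n : ℕ} (a : Fin n → ℝ)
    (x : Fin n → 𝒳) (h : EuclideanSpace ℝ (Fin p)) : ℝ :=
  ∑ i, a i * (ρ (x i) θs - ρ (x i) (θs + (√(n : ℝ))⁻¹ • h))
    - avgWeight a * (h ⬝ᵥ V *ᵥ (√(n : ℝ) • (θhat n a x - θs)))
    + 1 / 2 * (avgWeight a * (h ⬝ᵥ V *ᵥ h))

/-- The weighted M-LAN property along the weight sequence `α`, for data drawn i.i.d. from `Q`:
`sup_{h ∈ K} |R_{n,α}(h)| → 0` in probability for every compact `K`. -/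
def WeightedMLAN [MeasurableSpace 𝒳] (Q : Measure 𝒳) (ρ : 𝒳 → EuclideanSpace ℝ (Fin p) → ℝ)
    (θhat : ∀ n : ℕ, (Fin n → ℝ) → (Fin n → 𝒳) → EuclideanSpace ℝ (Fin p))
    (θs : EuclideanSpace ℝ (Fin p)) (V : Matrix (Fin p) (Fin p) ℝ) (α : ℕ → ℝ) : Prop :=
  ∀ K : Set (EuclideanSpace ℝ (Fin p)), IsCompact K →
    TendstoZeroInProb (iidLaw Q) fun n x =>
      ⨆ h ∈ K, ENNReal.ofReal |lanRemainder ρ θhat θs V (firstTerms α n) x h|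

/-- The weighted M-posterior with weight sequence `α` concentrates around `θs` at rate `√n`. -/
def Concentrates [MeasurableSpace 𝒳] (Q : Measure 𝒳) (Θ : Set (EuclideanSpace ℝ (Fin p)))
    (ρ : 𝒳 → EuclideanSpace ℝ (Fin p) → ℝ) (prior : EuclideanSpace ℝ (Fin p) → ℝ)
    (θs : EuclideanSpace ℝ (Fin p)) (α : ℕ → ℝ) : Prop :=
  ∀ r : ℕ → ℝ, Tendsto r atTop atTop →
    Tendsto (fun n : ℕ => ∫⁻ x, posterior Θ ρ prior (firstTerms α n) x
      {θ | r n < ‖√(n : ℝ) • (θ - θs)‖} ∂(iidLaw Q n)) atTop (𝓝 0)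

end MPosterior

end

/-! Fix the weights. In the local parameter `h = √n (θ - θ*)`, completing the square in the LAN
expansion writes the posterior density as a constant times `exp R(h)`, a Gaussian kernel centred at
the estimator, and the prior (`posteriorWeight_eq`). On a fixed local ball, with high probability,
`R` is small and the prior nearly constant. The posterior density `f` is then proportional to the
Gaussian density `g` up to a factor `κ` near 1. The mass of `f` on the ball calibrates the unknown
constant (`lintegral_tsub_le_of_proportional`), so `∫ (g - f)⁺`, which dominates total variation, is
small once both laws put little mass outside the ball.

For the posterior this is the concentration hypothesis, turned into a fixed radius by
`exists_radius_of_tendsto`. For the Gaussian one needs tightness of `√n (θhat - θ*)`, which is not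
assumed but derived in `norm_center_le`: were the centre far away, a unit local shift towards it
would multiply the kernel by a large factor, and the shifted ball would carry posterior mass above
1.

Random weights are realized as one infinite i.i.d. sequence. By the strong law almost every sequence
is admissible, with averages eventually bounded below (`ae_weights`), so the fixed-weight result
holds almost surely. Tonelli and dominated convergence then integrate the weights out
(`tendsto_prod_of_ae_tendsto`). -/

noncomputable section

namespace MPosterior

/-! ### Gaussian densities and tails. -/

section Gaussian

open scoped MatrixOrder

/-- The standard Gaussian measure has a density proportional to `exp (-‖x‖² / 2)`. -/
lemma exists_stdGaussian_eq_withDensity (E : Type*) [NormedAddCommGroup E] [InnerProductSpace ℝ E]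
    [FiniteDimensional ℝ E] [MeasurableSpace E] [BorelSpace E] :
    ∃ C : ℝ, 0 < C ∧ stdGaussian E =
      volume.withDensity fun x => ENNReal.ofReal (C * Real.exp (-(1 / 2) * ‖x‖ ^ 2)) := by
  have hint (w : E) : Integrable (fun v : E =>
      Complex.exp (-(1 / 2 : ℂ) * (‖v‖ : ℂ) ^ 2 + Complex.I * (inner ℝ w v : ℝ))) :=
    GaussianFourier.integrable_cexp_neg_mul_sq_norm_add (by norm_num) _ _
  have hfun (w : E) := GaussianFourier.integral_cexp_neg_mul_sq_norm_add (b := (1 / 2 : ℂ)) (V := E)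
    (by norm_num) Complex.I w
  have hreal : Integrable (fun v : E => Real.exp (-(1 / 2) * ‖v‖ ^ 2)) := by
    have := (hint 0).re
    refine this.congr (Eventually.of_forall fun v => ?_)
    have : (-(1 / 2 : ℂ) * (‖v‖ : ℂ) ^ 2 + Complex.I * (inner ℝ (0 : E) v : ℝ)) =
        ((-(1 / 2) * ‖v‖ ^ 2 : ℝ) : ℂ) := by simp
    simp only [this, ← Complex.ofReal_exp]
    rfl
  set N : ℝ := ∫ v : E, Real.exp (-(1 / 2) * ‖v‖ ^ 2) with hN
  have hNpos : 0 < N := integral_exp_pos hreal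
  -- The Fourier integral at frequency 0 identifies `N` with the prefactor appearing at every
  -- frequency, so dividing by `N` leaves exactly the characteristic function.
  have hNC : (N : ℂ) = ((Real.pi : ℂ) / (1 / 2)) ^ ((Module.finrank ℝ E : ℂ) / 2) := by
    have := hfun 0
    simp only [norm_zero, inner_zero_left, Complex.ofReal_zero, mul_zero, add_zero, ne_eq,
      OfNat.ofNat_ne_zero, not_false_eq_true, zero_pow, zero_div, Complex.exp_zero, mul_one] at this
    rw [← this, hN, ← integral_complex_ofReal]
    congr 1 with v
    push_cast
    rfl
  have hmeas : Measurable fun x : E => ENNReal.ofReal (N⁻¹ * Real.exp (-(1 / 2) * ‖x‖ ^ 2)) := by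
    fun_prop
  refine ⟨N⁻¹, inv_pos.2 hNpos, ?_⟩
  have : IsFiniteMeasure (volume.withDensity fun x : E =>
      ENNReal.ofReal (N⁻¹ * Real.exp (-(1 / 2) * ‖x‖ ^ 2))) :=
    isFiniteMeasure_withDensity_ofReal (hreal.const_mul _).2
  apply Measure.ext_of_charFun
  ext t
  rw [charFun_stdGaussian, charFun_apply,
    integral_withDensity_eq_integral_toReal_smul hmeas (Eventually.of_forall fun x => by simp)]
  have hpt (x : E) : (ENNReal.ofReal (N⁻¹ * Real.exp (-(1 / 2) * ‖x‖ ^ 2))).toReal •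
      Complex.exp ((inner ℝ x t : ℝ) * Complex.I) =
      (N : ℂ)⁻¹ * Complex.exp (-(1 / 2 : ℂ) * (‖x‖ : ℂ) ^ 2 + Complex.I * (inner ℝ t x : ℝ)) := by
    rw [ENNReal.toReal_ofReal (by positivity), Complex.exp_add, Complex.real_smul,
      real_inner_comm, mul_comm Complex.I]
    push_cast
    ring
  simp_rw [hpt]
  rw [integral_const_mul, hfun, ← hNC, ← mul_assoc,
    inv_mul_cancel₀ (by exact_mod_cast hNpos.ne'), one_mul]
  congr 1
  rw [Complex.I_sq]
  ring

/-- Densities transform by composition under a measurable map that scales `μ`. -/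
lemma map_withDensity_comp {E : Type*} [MeasurableSpace E] {μ : Measure E} {k : ℝ≥0∞}
    {φ : E → E} (hφ : Measurable φ) (hk : μ.map φ = k • μ) {f : E → ℝ≥0∞} (hf : Measurable f) :
    (μ.withDensity fun x => f (φ x)).map φ = μ.withDensity fun x => k * f x := by
  ext s hs
  rw [Measure.map_apply hφ hs, withDensity_apply _ (hφ hs), withDensity_apply _ hs,
    ← setLIntegral_map hs hf hφ, hk, Measure.restrict_smul, lintegral_smul_measure,
    lintegral_const_mul _ hf, smul_eq_mul]

variable {p : ℕ}

/-- Scaling the covariance of a Gaussian by `c⁻¹` scales its fluctuations by `(√c)⁻¹`. -/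
lemma multivariateGaussian_inv_smul_eq_map {S : Matrix (Fin p) (Fin p) ℝ} (hS : S.PosSemidef)
    {c : ℝ} (hc : 0 < c) (m : EuclideanSpace ℝ (Fin p)) :
    multivariateGaussian m (c⁻¹ • S) = (stdGaussian (EuclideanSpace ℝ (Fin p))).map
      fun x => m + (√c)⁻¹ • toEuclideanCLM (𝕜 := ℝ) (CFC.sqrt S) x := by
  have hsq : CFC.sqrt (c⁻¹ • S) = (√c)⁻¹ • CFC.sqrt S := by
    apply CFC.sqrt_unique
    · rw [smul_mul_smul_comm, CFC.sqrt_mul_sqrt_self _ hS.nonneg, ← mul_inv,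
        Real.mul_self_sqrt hc.le]
    · exact smul_nonneg (by positivity) (CFC.sqrt_nonneg S)
  rw [multivariateGaussian, hsq]
  congr 1 with x
  simp

/-- With `S = √(V⁻¹)`, `S (S V) = V⁻¹ V = 1`, and a one-sided inverse of a square matrix is
two-sided. -/
lemma sqrt_inv_conj {V : Matrix (Fin p) (Fin p) ℝ} (hV : V.PosDef) :
    CFC.sqrt V⁻¹ * V * CFC.sqrt V⁻¹ = 1 := by
  have h := CFC.sqrt_mul_sqrt_self V⁻¹ hV.inv.posSemidef.nonneg
  have h1 : CFC.sqrt V⁻¹ * (CFC.sqrt V⁻¹ * V) = 1 := by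
    rw [← mul_assoc, h, Matrix.nonsing_inv_mul _ hV.det_pos.ne'.isUnit]
  exact mul_eq_one_comm.1 h1

/-- `√(V⁻¹)` whitens the form of `V`; the change of variables to the standard Gaussian, its
invertibility and the coercivity of `V` all come from this. -/
lemma inner_sqrt_inv {V : Matrix (Fin p) (Fin p) ℝ} (hV : V.PosDef)
    (x : EuclideanSpace ℝ (Fin p)) :
    inner ℝ (toEuclideanCLM (𝕜 := ℝ) (CFC.sqrt V⁻¹) x)
      (toEuclideanCLM (𝕜 := ℝ) V (toEuclideanCLM (𝕜 := ℝ) (CFC.sqrt V⁻¹) x)) = ‖x‖ ^ 2 := by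
  have hsa : IsSelfAdjoint (toEuclideanCLM (𝕜 := ℝ) (CFC.sqrt V⁻¹)) :=
    (CFC.sqrt_nonneg V⁻¹).isSelfAdjoint.map _
  conv_lhs => rw [← hsa.adjoint_eq]
  rw [ContinuousLinearMap.adjoint_inner_left, hsa.adjoint_eq]
  have : toEuclideanCLM (𝕜 := ℝ) (CFC.sqrt V⁻¹) (toEuclideanCLM (𝕜 := ℝ) V
      (toEuclideanCLM (𝕜 := ℝ) (CFC.sqrt V⁻¹) x)) = x := by
    have h := congrArg (fun A => toEuclideanCLM (𝕜 := ℝ) A x) (sqrt_inv_conj hV)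
    simpa [map_mul] using h
  rw [this, real_inner_self_eq_norm_sq]

lemma det_sqrt_inv_ne_zero {V : Matrix (Fin p) (Fin p) ℝ} (hV : V.PosDef) :
    LinearMap.det (toEuclideanCLM (𝕜 := ℝ) (CFC.sqrt V⁻¹)).toLinearMap ≠ 0 := by
  intro h
  obtain ⟨x, hx, hx0⟩ := (Submodule.ne_bot_iff _).1 (LinearMap.bot_lt_ker_of_det_eq_zero h).ne'
  have h1 := inner_sqrt_inv hV x
  have h2 : toEuclideanCLM (𝕜 := ℝ) (CFC.sqrt V⁻¹) x = 0 := hx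
  rw [h2, map_zero, inner_zero_left] at h1
  exact hx0 (norm_eq_zero.1 (pow_eq_zero_iff two_ne_zero |>.1 h1.symm))

/-- A positive definite matrix is coercive. -/
lemma exists_coercive {V : Matrix (Fin p) (Fin p) ℝ} (hV : V.PosDef) :
    ∃ l : ℝ, 0 < l ∧ ∀ y : EuclideanSpace ℝ (Fin p),
      l * ‖y‖ ^ 2 ≤ inner ℝ y (toEuclideanCLM (𝕜 := ℝ) V y) := by
  set T := toEuclideanCLM (𝕜 := ℝ) (CFC.sqrt V⁻¹) with hT
  -- For `y = T x` the form equals `‖x‖²` and `‖y‖ ≤ ‖T‖ ‖x‖`. The `+ 1` keeps the constant positive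
  -- when `p = 0`.
  refine ⟨((‖T‖ + 1) ^ 2)⁻¹, by positivity, fun y => ?_⟩
  obtain ⟨x, rfl⟩ : ∃ x, T x = y :=
    (LinearMap.equivOfDetNeZero _ (det_sqrt_inv_ne_zero hV)).surjective y
  rw [hT, inner_sqrt_inv hV, ← hT, inv_mul_le_iff₀ (by positivity), ← mul_pow]
  have := T.le_opNorm x
  gcongr
  exact this.trans (by gcongr; linarith)

/-- The unnormalized Gaussian density with mean `m` and covariance `(c • V)⁻¹`. -/
def gaussKernel (V : Matrix (Fin p) (Fin p) ℝ) (c : ℝ) (m θ : EuclideanSpace ℝ (Fin p)) : ℝ :=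
  Real.exp (-(c / 2) * inner ℝ (θ - m) (toEuclideanCLM (𝕜 := ℝ) V (θ - m)))

/-- The Gaussian density with mean `m` and covariance `(c • V)⁻¹`. -/
def gaussDensity (V : Matrix (Fin p) (Fin p) ℝ) (c : ℝ) (m θ : EuclideanSpace ℝ (Fin p)) : ℝ≥0∞ :=
  ENNReal.ofReal (gaussKernel V c m θ) / ∫⁻ θ', ENNReal.ofReal (gaussKernel V c m θ')

lemma gaussKernel_pos (V : Matrix (Fin p) (Fin p) ℝ) (c : ℝ) (m θ : EuclideanSpace ℝ (Fin p)) :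
    0 < gaussKernel V c m θ := Real.exp_pos _

/-- An affine image of the standard Gaussian has constant Jacobian. `K` stays unspecified, since
total mass 1 determines it afterwards. -/
lemma exists_multivariateGaussian_eq_withDensity {V : Matrix (Fin p) (Fin p) ℝ} (hV : V.PosDef)
    {c : ℝ} (hc : 0 < c) (m : EuclideanSpace ℝ (Fin p)) :
    ∃ K : ℝ≥0∞, multivariateGaussian m (c⁻¹ • V⁻¹) =
      volume.withDensity fun θ => K * ENNReal.ofReal (gaussKernel V c m θ) := by
  obtain ⟨C, hC, hstd⟩ := exists_stdGaussian_eq_withDensity (EuclideanSpace ℝ (Fin p))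
  set T := toEuclideanCLM (𝕜 := ℝ) (CFC.sqrt V⁻¹) with hT
  have hsc : √c ^ 2 = c := Real.sq_sqrt hc.le
  have hs0 : √c ≠ 0 := (Real.sqrt_pos.2 hc).ne'
  have hdet : LinearMap.det ((√c)⁻¹ • T).toLinearMap ≠ 0 := by
    rw [ContinuousLinearMap.toLinearMap_smul, LinearMap.det_smul]
    exact mul_ne_zero (by positivity) (det_sqrt_inv_ne_zero hV)
  have hmap : (volume : Measure (EuclideanSpace ℝ (Fin p))).map (fun x => m + (√c)⁻¹ • T x) =
      ENNReal.ofReal |(LinearMap.det ((√c)⁻¹ • T).toLinearMap)⁻¹| • volume := by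
    have h := Measure.map_linearMap_addHaar_eq_smul_addHaar
      (volume : Measure (EuclideanSpace ℝ (Fin p))) hdet
    have hcomp : (fun x => m + (√c)⁻¹ • T x) = (fun x => m + x) ∘ ((√c)⁻¹ • T).toLinearMap := rfl
    have hm : Measurable ((√c)⁻¹ • T).toLinearMap := ((√c)⁻¹ • T).continuous.measurable
    rw [hcomp, ← Measure.map_map (by fun_prop) hm, h,
      Measure.map_smul, map_add_left_eq_self]
  have hf : Measurable fun θ => ENNReal.ofReal (C * gaussKernel V c m θ) := by
    unfold gaussKernel
    fun_prop
  have hker (x : EuclideanSpace ℝ (Fin p)) :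
      gaussKernel V c m (m + (√c)⁻¹ • T x) = Real.exp (-(1 / 2) * ‖x‖ ^ 2) := by
    rw [gaussKernel, add_sub_cancel_left, map_smul, real_inner_smul_left, real_inner_smul_right,
      hT, inner_sqrt_inv hV]
    congr 1
    field_simp
    rw [hsc]
  refine ⟨ENNReal.ofReal |(LinearMap.det ((√c)⁻¹ • T).toLinearMap)⁻¹| * ENNReal.ofReal C, ?_⟩
  rw [multivariateGaussian_inv_smul_eq_map hV.inv.posSemidef hc, hstd]
  have := map_withDensity_comp (by fun_prop) hmap hf
  simp only [hker] at this
  rw [this]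
  congr 1 with θ
  rw [ENNReal.ofReal_mul hC.le, mul_assoc]

lemma measurable_gaussKernel (V : Matrix (Fin p) (Fin p) ℝ) (c : ℝ)
    (m : EuclideanSpace ℝ (Fin p)) : Measurable (gaussKernel V c m) := by
  unfold gaussKernel
  fun_prop

lemma multivariateGaussian_eq_withDensity_gaussDensity {V : Matrix (Fin p) (Fin p) ℝ} (hV : V.PosDef)
    {c : ℝ} (hc : 0 < c) (m : EuclideanSpace ℝ (Fin p)) :
    multivariateGaussian m (c⁻¹ • V⁻¹) = volume.withDensity (gaussDensity V c m) ∧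
      ∫⁻ θ, ENNReal.ofReal (gaussKernel V c m θ) ≠ 0 ∧
      ∫⁻ θ, ENNReal.ofReal (gaussKernel V c m θ) ≠ ∞ := by
  obtain ⟨K, hK⟩ := exists_multivariateGaussian_eq_withDensity hV hc m
  have hone : K * ∫⁻ θ, ENNReal.ofReal (gaussKernel V c m θ) = 1 := by
    rw [← lintegral_const_mul _ (measurable_gaussKernel V c m).ennreal_ofReal,
      ← setLIntegral_univ, ← withDensity_apply _ MeasurableSet.univ, ← hK, measure_univ]
  have h0 : ∫⁻ θ, ENNReal.ofReal (gaussKernel V c m θ) ≠ 0 := by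
    intro h
    simp [h] at hone
  have hKne : K ≠ 0 := by
    rintro rfl
    simp at hone
  have htop : ∫⁻ θ, ENNReal.ofReal (gaussKernel V c m θ) ≠ ∞ := by
    intro h
    simp [h, ENNReal.mul_top hKne] at hone
  refine ⟨?_, h0, htop⟩
  rw [hK]
  congr 1 with θ
  rw [gaussDensity, ENNReal.eq_inv_of_mul_eq_one_left hone, mul_comm, ENNReal.div_eq_inv_mul,
    mul_comm]

/-- Uniform tightness of Gaussians in the scale of their standard deviation. -/
lemma exists_gaussian_tail_le {V : Matrix (Fin p) (Fin p) ℝ} (hV : V.PosDef) {δ : ℝ≥0∞}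
    (hδ : 0 < δ) : ∃ r : ℝ, ∀ c : ℝ, 0 < c → ∀ m : EuclideanSpace ℝ (Fin p),
      multivariateGaussian m (c⁻¹ • V⁻¹) {θ | r < √c * ‖θ - m‖} ≤ δ := by
  set T := toEuclideanCLM (𝕜 := ℝ) (CFC.sqrt V⁻¹) with hT
  -- `√c ‖θ - m‖` is distributed as `‖T x‖` with `x` standard Gaussian, whatever `c` and `m`, so one
  -- radius serves all.
  have hlim : Tendsto (fun k : ℕ => stdGaussian (EuclideanSpace ℝ (Fin p)) {x | (k : ℝ) < ‖T x‖})
      atTop (𝓝 0) := by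
    have hI : ⋂ k : ℕ, {x | (k : ℝ) < ‖T x‖} = (∅ : Set (EuclideanSpace ℝ (Fin p))) := by
      ext x
      obtain ⟨k, hk⟩ := exists_nat_ge ‖T x‖
      simpa using ⟨k, hk⟩
    rw [← measure_empty (μ := stdGaussian (EuclideanSpace ℝ (Fin p))), ← hI]
    refine tendsto_measure_iInter_atTop (fun k => ?_) (fun i j hij x hx => ?_)
      ⟨0, measure_ne_top _ _⟩
    · exact (measurableSet_lt measurable_const (by fun_prop)).nullMeasurableSet
    · exact lt_of_le_of_lt (Nat.cast_le.2 hij : (i : ℝ) ≤ j) hx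
  obtain ⟨k, hk⟩ := (hlim.eventually_le_const hδ).exists
  refine ⟨k, fun c hc m => le_trans (le_of_eq ?_) hk⟩
  rw [multivariateGaussian_inv_smul_eq_map hV.inv.posSemidef hc, Measure.map_apply (by fun_prop)
    (measurableSet_lt measurable_const (by fun_prop))]
  congr 1 with x
  have hs0 : √c ≠ 0 := (Real.sqrt_pos.2 hc).ne'
  simp only [Set.preimage_ofPred_eq, add_sub_cancel_left, Set.mem_ofPred_eq, norm_smul, norm_inv,
    Real.norm_eq_abs, abs_of_nonneg (Real.sqrt_nonneg c), mul_inv_cancel_left₀ hs0, ← hT]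

end Gaussian

/-! ### Comparing two probability densities. -/

section Densities

variable {E : Type*} [MeasurableSpace E] {μ : Measure E} {f g : E → ℝ≥0∞}

/-- The excess of `g` bounds `ν(A) - μ(A)` for every `A`; passing to `Aᶜ` gives the other sign, as
both masses are 1. -/
lemma dTV_withDensity_le (hf : Measurable f) (hf1 : ∫⁻ x, f x ∂μ = 1)
    (hg1 : ∫⁻ x, g x ∂μ = 1) :
    dTV (μ.withDensity f) (μ.withDensity g) ≤ ∫⁻ x, (g x - f x) ∂μ := by
  have : IsProbabilityMeasure (μ.withDensity f) :=
    ⟨by rw [withDensity_apply _ MeasurableSet.univ, setLIntegral_univ, hf1]⟩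
  have : IsProbabilityMeasure (μ.withDensity g) :=
    ⟨by rw [withDensity_apply _ MeasurableSet.univ, setLIntegral_univ, hg1]⟩
  have hD : ∫⁻ x, (g x - f x) ∂μ ≠ ∞ :=
    ne_top_of_le_ne_top (by simp [hg1]) (lintegral_mono fun x => tsub_le_self)
  have key (A : Set E) (hA : MeasurableSet A) : (μ.withDensity g).real A ≤
      (μ.withDensity f).real A + (∫⁻ x, (g x - f x) ∂μ).toReal := by
    rw [measureReal_def, measureReal_def, ← ENNReal.toReal_add (measure_ne_top _ _) hD]
    refine ENNReal.toReal_mono (ENNReal.add_ne_top.2 ⟨measure_ne_top _ _, hD⟩) ?_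
    rw [withDensity_apply _ hA, withDensity_apply _ hA]
    calc ∫⁻ x in A, g x ∂μ ≤ ∫⁻ x in A, (f x + (g x - f x)) ∂μ :=
          lintegral_mono fun x => le_add_tsub
      _ = ∫⁻ x in A, f x ∂μ + ∫⁻ x in A, (g x - f x) ∂μ := lintegral_add_left hf _
      _ ≤ _ := by gcongr; exact Measure.restrict_le_self
  refine iSup₂_le fun A hA => ENNReal.ofReal_le_of_le_toReal (abs_le.2 ⟨?_, ?_⟩)
  · linarith [key A hA]
  · have := key Aᶜ hA.compl
    rw [probReal_compl_eq_one_sub hA, probReal_compl_eq_one_sub hA] at this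
    linarith

/-- If `f` and `g` are proportional on `B` up to the factor `κ`, and `g` is a probability density,
then `g` exceeds `f` by little. -/
lemma lintegral_tsub_le_of_proportional (hg : Measurable g) (hg1 : ∫⁻ x, g x ∂μ = 1)
    {B : Set E} (hB : MeasurableSet B) {c κ : ℝ≥0∞} (hκ0 : κ ≠ 0) (hκ : κ ≠ ∞)
    (hfg : ∀ x ∈ B, f x ≤ c * κ * g x) (hgf : ∀ x ∈ B, c * g x ≤ κ * f x) :
    ∫⁻ x, (g x - f x) ∂μ ≤ ∫⁻ x in Bᶜ, g x ∂μ + (1 - (∫⁻ x in B, f x ∂μ) / κ ^ 2) := by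
  -- Integrating `f ≤ c κ g` over `B` bounds `c` from below by the mass of `f` divided by `κ`; hence
  -- `f ≥ (c / κ) g ≥ q g` on `B`.
  set q := (∫⁻ x in B, f x ∂μ) / κ ^ 2 with hq
  have hqc : q ≤ c / κ := by
    have h1 : ∫⁻ x in B, f x ∂μ ≤ c * κ := by
      calc ∫⁻ x in B, f x ∂μ ≤ ∫⁻ x in B, c * κ * g x ∂μ := setLIntegral_mono' hB hfg
        _ = c * κ * ∫⁻ x in B, g x ∂μ := lintegral_const_mul _ hg
        _ ≤ c * κ * ∫⁻ x, g x ∂μ := by gcongr; exact Measure.restrict_le_self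
        _ = c * κ := by rw [hg1, mul_one]
    rw [hq]
    refine ENNReal.div_le_of_le_mul (h1.trans (le_of_eq ?_))
    rw [pow_two, ← mul_assoc, ENNReal.div_mul_cancel hκ0 hκ]
  have hpt : ∀ x ∈ B, g x - f x ≤ (1 - q) * g x := by
    intro x hx
    have h2 : q * g x ≤ f x := by
      calc q * g x ≤ c / κ * g x := by gcongr
        _ = c * g x / κ := by rw [ENNReal.mul_div_right_comm]
        _ ≤ f x := ENNReal.div_le_of_le_mul (by rw [mul_comm (f x)]; exact hgf x hx)
    rw [tsub_le_iff_right]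
    calc g x = 1 * g x := (one_mul _).symm
      _ ≤ (1 - q + q) * g x := by gcongr; exact le_tsub_add
      _ = (1 - q) * g x + q * g x := add_mul _ _ _
      _ ≤ _ := by gcongr
  rw [← lintegral_add_compl _ hB, add_comm]
  gcongr
  · exact tsub_le_self
  · calc ∫⁻ x in B, (g x - f x) ∂μ ≤ ∫⁻ x in B, (1 - q) * g x ∂μ := setLIntegral_mono' hB hpt
      _ = (1 - q) * ∫⁻ x in B, g x ∂μ := lintegral_const_mul _ hg
      _ ≤ (1 - q) * ∫⁻ x, g x ∂μ := by gcongr; exact Measure.restrict_le_self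
      _ = 1 - q := by rw [hg1, mul_one]

end Densities

/-! ### Local coordinates and tightness of the Gaussian centre. -/

section Local

variable {p : ℕ}

lemma gaussKernel_local (V : Matrix (Fin p) (Fin p) ℝ) (b : ℝ) (n : ℕ)
    (θs m θ : EuclideanSpace ℝ (Fin p)) :
    gaussKernel V (b * n) m θ =
      Real.exp (-(b / 2) * inner ℝ (√(n : ℝ) • (θ - θs) - √(n : ℝ) • (m - θs))
        (toEuclideanCLM (𝕜 := ℝ) V (√(n : ℝ) • (θ - θs) - √(n : ℝ) • (m - θs)))) := by
  rw [gaussKernel, ← smul_sub, sub_sub_sub_cancel_right, map_smul, real_inner_smul_left,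
    real_inner_smul_right, ← mul_assoc (√(n : ℝ)), Real.mul_self_sqrt n.cast_nonneg]
  congr 1
  ring

lemma inner_toEuclideanCLM_comm {V : Matrix (Fin p) (Fin p) ℝ} (hV : V.PosDef)
    (x y : EuclideanSpace ℝ (Fin p)) :
    inner ℝ x (toEuclideanCLM (𝕜 := ℝ) V y) = inner ℝ y (toEuclideanCLM (𝕜 := ℝ) V x) := by
  have hsa : IsSelfAdjoint (toEuclideanCLM (𝕜 := ℝ) V) :=
    IsSelfAdjoint.map (show IsSelfAdjoint V from hV.isHermitian) _
  rw [← ContinuousLinearMap.adjoint_inner_left, hsa.adjoint_eq, real_inner_comm]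

/-- A unit shift towards the mean increases the Gaussian kernel by a factor exponential in the
distance of the mean. -/
lemma gaussKernel_shift {V : Matrix (Fin p) (Fin p) ℝ} (hV : V.PosDef) {l b M : ℝ}
    (hl : ∀ y : EuclideanSpace ℝ (Fin p), l * ‖y‖ ^ 2 ≤ inner ℝ y (toEuclideanCLM (𝕜 := ℝ) V y))
    (hb : 0 < b) {n : ℕ} (hn : 0 < n) {θs m θ : EuclideanSpace ℝ (Fin p)} (hm : m ≠ θs)
    (hθ : ‖√(n : ℝ) • (θ - θs)‖ ≤ M) :
    Real.exp (b * (l * ‖√(n : ℝ) • (m - θs)‖ - ‖toEuclideanCLM (𝕜 := ℝ) V‖ * (M + 1))) *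
      gaussKernel V (b * n) m θ ≤
        gaussKernel V (b * n) m (θ + (√(n : ℝ))⁻¹ • ‖m - θs‖⁻¹ • (m - θs)) := by
  set W := toEuclideanCLM (𝕜 := ℝ) V with hW
  have hs0 : 0 < √(n : ℝ) := Real.sqrt_pos.2 (by exact_mod_cast hn)
  have hm0 : 0 < ‖m - θs‖ := norm_pos_iff.2 (sub_ne_zero.2 hm)
  rw [gaussKernel_local V b n θs, gaussKernel_local V b n θs, ← Real.exp_add, Real.exp_le_exp,
    ← hW]
  set h := √(n : ℝ) • (θ - θs) with hh
  set k := √(n : ℝ) • (m - θs) with hk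
  set u := ‖m - θs‖⁻¹ • (m - θs) with hu
  have hshift : √(n : ℝ) • (θ + (√(n : ℝ))⁻¹ • u - θs) = h + u := by
    rw [add_sub_right_comm, smul_add, smul_inv_smul₀ hs0.ne']
  have hun : ‖u‖ = 1 := by
    rw [hu, norm_smul, norm_inv, norm_norm, inv_mul_cancel₀ hm0.ne']
  have hku : k = ‖k‖ • u := by
    rw [hu, hk, norm_smul, smul_smul, Real.norm_of_nonneg hs0.le, mul_assoc,
      mul_inv_cancel₀ hm0.ne', mul_one]
  have hbd (y : EuclideanSpace ℝ (Fin p)) : inner ℝ u (W y) ≤ ‖W‖ * ‖y‖ := by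
    calc inner ℝ u (W y) ≤ ‖u‖ * ‖W y‖ := real_inner_le_norm _ _
      _ ≤ ‖W‖ * ‖y‖ := by rw [hun, one_mul]; exact W.le_opNorm y
  have h1 : l * ‖k‖ ≤ inner ℝ u (W k) := by
    have := hl u
    rw [hun, one_pow, mul_one] at this
    rw [hku, map_smul, real_inner_smul_right, norm_smul, norm_norm, hun, mul_one, mul_comm]
    gcongr
  have h2 : inner ℝ u (W h) ≤ ‖W‖ * M := (hbd h).trans (by gcongr)
  have h3 : inner ℝ u (W u) ≤ ‖W‖ := by simpa [hun] using hbd u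
  rw [hshift]
  -- In the exponent the shift by `u` gains `b ⟨u, W k⟩ ≥ b l ‖k‖` and loses at most `b ‖W‖ M` from
  -- `h` and `b ‖W‖ / 2` from `u` itself.
  have hexp : inner ℝ (h + u - k) (W (h + u - k)) = inner ℝ (h - k) (W (h - k)) +
      (2 * (inner ℝ u (W h) - inner ℝ u (W k)) + inner ℝ u (W u)) := by
    have hc := inner_toEuclideanCLM_comm hV (h - k) u
    rw [← hW] at hc
    rw [show h + u - k = (h - k) + u by abel]
    simp only [map_add, inner_add_left, inner_add_right, hc]
    simp only [map_sub, inner_sub_right]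
    ring
  rw [hexp]
  have hW0 := norm_nonneg W
  nlinarith

/-- The closed ball of radius `R` around `θs` in the local parameter `√n • (θ - θs)`. -/
def localBall (n : ℕ) (θs : EuclideanSpace ℝ (Fin p)) (R : ℝ) : Set (EuclideanSpace ℝ (Fin p)) :=
  {θ | ‖√(n : ℝ) • (θ - θs)‖ ≤ R}

lemma measurableSet_localBall (n : ℕ) (θs : EuclideanSpace ℝ (Fin p)) (R : ℝ) :
    MeasurableSet (localBall n θs R) :=
  measurableSet_le (by fun_prop) measurable_const

lemma localBall_mono {n : ℕ} {θs : EuclideanSpace ℝ (Fin p)} {M R : ℝ} (h : M ≤ R) :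
    localBall n θs M ⊆ localBall n θs R := fun _ hθ => le_trans hθ h

/-- A probability density which is locally proportional to a Gaussian kernel and puts mass at
least `1 / 2` on a ball forces the center of the Gaussian to be close to that ball. -/
lemma norm_center_le {V : Matrix (Fin p) (Fin p) ℝ} (hV : V.PosDef) {l b b₀ M : ℝ} (hl0 : 0 < l)
    (hl : ∀ y : EuclideanSpace ℝ (Fin p), l * ‖y‖ ^ 2 ≤ inner ℝ y (toEuclideanCLM (𝕜 := ℝ) V y))
    (hb₀ : 0 < b₀) (hb : b₀ ≤ b) (hM : 0 ≤ M) {n : ℕ} (hn : 0 < n)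
    {θs m : EuclideanSpace ℝ (Fin p)} {f : EuclideanSpace ℝ (Fin p) → ℝ≥0∞} (hf : Measurable f)
    (hf1 : ∫⁻ θ, f θ = 1) {c κ : ℝ≥0∞} (hκ : κ ≤ 2)
    (hfg : ∀ θ ∈ localBall n θs (M + 1), f θ ≤ c * κ * ENNReal.ofReal (gaussKernel V (b * n) m θ))
    (hgf : ∀ θ ∈ localBall n θs (M + 1), c * ENNReal.ofReal (gaussKernel V (b * n) m θ) ≤ κ * f θ)
    (hmass : 2⁻¹ ≤ ∫⁻ θ in localBall n θs M, f θ) :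
    ‖√(n : ℝ) • (m - θs)‖ ≤ (8 / b₀ + ‖toEuclideanCLM (𝕜 := ℝ) V‖ * (M + 1)) / l := by
  by_contra! hlt
  rw [div_lt_iff₀ hl0] at hlt
  have hs0 : 0 < √(n : ℝ) := Real.sqrt_pos.2 (by exact_mod_cast hn)
  have hW0 := norm_nonneg (toEuclideanCLM (𝕜 := ℝ) V)
  have hm : m ≠ θs := by
    rintro rfl
    simp only [sub_self, smul_zero, norm_zero, zero_mul] at hlt
    have : 0 < 8 / b₀ + ‖toEuclideanCLM (𝕜 := ℝ) V‖ * (M + 1) := by positivity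
    linarith
  have hm0 : 0 < ‖m - θs‖ := norm_pos_iff.2 (sub_ne_zero.2 hm)
  -- Since `exp t ≥ t + 1 ≥ 9`, the shift gives `f θ ≤ (κ² / 9) f (θ + v)` with `κ² ≤ 4`; the mass
  -- of the ball would be at most `4 / 9 < 1 / 2`.
  have ht : 8 ≤ b * (l * ‖√(n : ℝ) • (m - θs)‖ - ‖toEuclideanCLM (𝕜 := ℝ) V‖ * (M + 1)) := by
    calc (8 : ℝ) = b₀ * (8 / b₀) := by field_simp
      _ ≤ b * (8 / b₀) := by gcongr
      _ ≤ _ := by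
        have : 0 ≤ b := hb₀.le.trans hb
        gcongr
        linarith
  set v := (√(n : ℝ))⁻¹ • ‖m - θs‖⁻¹ • (m - θs) with hv
  have hvn : ‖√(n : ℝ) • v‖ = 1 := by
    rw [hv, smul_inv_smul₀ hs0.ne', norm_smul, norm_inv, norm_norm, inv_mul_cancel₀ hm0.ne']
  have hpt : ∀ θ ∈ localBall n θs M, f θ ≤ 4 * ENNReal.ofReal (1 / 9) * f (θ + v) := by
    intro θ hθ
    have hθ' : θ + v ∈ localBall n θs (M + 1) := by
      change ‖√(n : ℝ) • (θ + v - θs)‖ ≤ M + 1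
      rw [add_sub_right_comm, smul_add]
      refine (norm_add_le _ _).trans ?_
      rw [hvn]
      gcongr
      exact hθ
    have hk : gaussKernel V (b * n) m θ ≤ 1 / 9 * gaussKernel V (b * n) m (θ + v) := by
      have h1 := gaussKernel_shift hV hl (hb₀.trans_le hb) hn hm hθ
      have h2 : 9 * gaussKernel V (b * n) m θ ≤ gaussKernel V (b * n) m (θ + v) := by
        refine le_trans ?_ h1
        have := (gaussKernel_pos V (b * n) m θ).le
        gcongr
        linarith [Real.add_one_le_exp
          (b * (l * ‖√(n : ℝ) • (m - θs)‖ - ‖toEuclideanCLM (𝕜 := ℝ) V‖ * (M + 1)))]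
      linarith
    calc f θ ≤ c * κ * ENNReal.ofReal (gaussKernel V (b * n) m θ) :=
          hfg θ (localBall_mono (by linarith) hθ)
      _ ≤ c * κ * ENNReal.ofReal (1 / 9 * gaussKernel V (b * n) m (θ + v)) := by gcongr
      _ = κ * ENNReal.ofReal (1 / 9) * (c * ENNReal.ofReal (gaussKernel V (b * n) m (θ + v))) := by
          rw [ENNReal.ofReal_mul (by norm_num)]
          ring
      _ ≤ κ * ENNReal.ofReal (1 / 9) * (κ * f (θ + v)) := mul_le_mul' le_rfl (hgf _ hθ')
      _ = κ * κ * ENNReal.ofReal (1 / 9) * f (θ + v) := by ring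
      _ ≤ 2 * 2 * ENNReal.ofReal (1 / 9) * f (θ + v) := by gcongr
      _ = _ := by norm_num
  have hle : ∫⁻ θ in localBall n θs M, f θ ≤ 4 * ENNReal.ofReal (1 / 9) := by
    calc ∫⁻ θ in localBall n θs M, f θ
        ≤ ∫⁻ θ in localBall n θs M, 4 * ENNReal.ofReal (1 / 9) * f (θ + v) :=
          setLIntegral_mono' (measurableSet_localBall n θs M) hpt
      _ = 4 * ENNReal.ofReal (1 / 9) * ∫⁻ θ in localBall n θs M, f (θ + v) :=
          lintegral_const_mul _ (by fun_prop)
      _ ≤ 4 * ENNReal.ofReal (1 / 9) * ∫⁻ θ, f (θ + v) := by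
          gcongr
          exact Measure.restrict_le_self
      _ = 4 * ENNReal.ofReal (1 / 9) := by rw [lintegral_add_right_eq_self f v, hf1, mul_one]
  have hnum : 4 * ENNReal.ofReal (1 / 9) < 2⁻¹ := by
    rw [show (4 : ℝ≥0∞) = ENNReal.ofReal 4 by norm_num, ← ENNReal.ofReal_mul (by norm_num),
      show (2⁻¹ : ℝ≥0∞) = ENNReal.ofReal 2⁻¹ by rw [ENNReal.ofReal_inv_of_pos (by norm_num)]; simp]
    exact (ENNReal.ofReal_lt_ofReal_iff (by norm_num)).2 (by norm_num)
  exact absurd (hmass.trans hle) (not_le.2 hnum)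

/-- A probability density which concentrates on the ball of radius `M`, and is proportional up to
the factor `κ` to a Gaussian kernel on a sufficiently large ball, is close to the Gaussian. -/
lemma exists_radius_lintegral_tsub_le {V : Matrix (Fin p) (Fin p) ℝ} (hV : V.PosDef) {b₀ M : ℝ}
    (hb₀ : 0 < b₀) (hM : 0 ≤ M) {δ : ℝ≥0∞} (hδ : 0 < δ) :
    ∃ R, M + 1 ≤ R ∧ ∀ n : ℕ, 0 < n → ∀ b, b₀ ≤ b → ∀ θs m : EuclideanSpace ℝ (Fin p),
      ∀ f : EuclideanSpace ℝ (Fin p) → ℝ≥0∞, Measurable f → ∫⁻ θ, f θ = 1 →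
      ∀ c κ : ℝ≥0∞, κ ≠ 0 → κ ≤ 2 →
      (∀ θ ∈ localBall n θs R, f θ ≤ c * κ * ENNReal.ofReal (gaussKernel V (b * n) m θ)) →
      (∀ θ ∈ localBall n θs R, c * ENNReal.ofReal (gaussKernel V (b * n) m θ) ≤ κ * f θ) →
      2⁻¹ ≤ ∫⁻ θ in localBall n θs M, f θ →
      ∫⁻ θ, (gaussDensity V (b * n) m θ - f θ) ≤
        δ + (1 - (∫⁻ θ in localBall n θs M, f θ) / κ ^ 2) := by
  obtain ⟨l, hl0, hl⟩ := exists_coercive hV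
  obtain ⟨r, hr⟩ := exists_gaussian_tail_le hV hδ
  set L := (8 / b₀ + ‖toEuclideanCLM (𝕜 := ℝ) V‖ * (M + 1)) / l with hL
  -- `L` bounds the distance to the centre, and `|r| / √b₀` is the Gaussian tail radius in local
  -- units, uniform over `b ≥ b₀`.
  refine ⟨max (M + 1) (L + |r| / √b₀), le_max_left _ _, ?_⟩
  set R := max (M + 1) (L + |r| / √b₀) with hR
  intro n hn b hb θs m f hf hf1 c κ hκ0 hκ2 hfg hgf hmass
  have hn' : (0 : ℝ) < n := by exact_mod_cast hn
  have hbn : 0 < b * n := mul_pos (hb₀.trans_le hb) hn'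
  have hMR : M + 1 ≤ R := le_max_left _ _
  have hcenter : ‖√(n : ℝ) • (m - θs)‖ ≤ L := norm_center_le hV hl0 hl hb₀ hb hM hn hf hf1 hκ2
    (fun θ hθ => hfg θ (localBall_mono hMR hθ)) (fun θ hθ => hgf θ (localBall_mono hMR hθ)) hmass
  obtain ⟨hG, hI0, hItop⟩ := multivariateGaussian_eq_withDensity_gaussDensity hV hbn m
  have hgm : Measurable (gaussDensity V (b * n) m) :=
    (measurable_gaussKernel V (b * n) m).ennreal_ofReal.div_const _
  have hg1 : ∫⁻ θ, gaussDensity V (b * n) m θ = 1 := by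
    rw [← setLIntegral_univ, ← withDensity_apply _ MeasurableSet.univ, ← hG, measure_univ]
  set I := ∫⁻ θ, ENNReal.ofReal (gaussKernel V (b * n) m θ) with hI
  have hker (θ : EuclideanSpace ℝ (Fin p)) : ENNReal.ofReal (gaussKernel V (b * n) m θ) =
      I * gaussDensity V (b * n) m θ := by
    rw [gaussDensity, ← hI, ENNReal.mul_div_cancel hI0 hItop]
  have htail : ∫⁻ θ in (localBall n θs R)ᶜ, gaussDensity V (b * n) m θ ≤ δ := by
    rw [← withDensity_apply _ (measurableSet_localBall n θs R).compl, ← hG]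
    refine (measure_mono fun θ hθ => ?_).trans (hr (b * n) hbn m)
    have h1 : R < ‖√(n : ℝ) • (θ - θs)‖ := not_le.1 hθ
    have h2 : ‖√(n : ℝ) • (θ - θs)‖ ≤ √(n : ℝ) * ‖θ - m‖ + L := by
      rw [show θ - θs = (θ - m) + (m - θs) by abel, smul_add]
      refine (norm_add_le _ _).trans ?_
      rw [norm_smul √(n : ℝ) (θ - m), Real.norm_of_nonneg (Real.sqrt_nonneg _)]
      gcongr
    have h3 : L + |r| / √b₀ ≤ R := le_max_right _ _
    have h4 : |r| / √b₀ < √(n : ℝ) * ‖θ - m‖ := by linarith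
    have hb₀s : 0 < √b₀ := Real.sqrt_pos.2 hb₀
    rw [div_lt_iff₀ hb₀s] at h4
    change r < √(b * n) * ‖θ - m‖
    calc r ≤ |r| := le_abs_self r
      _ < √(n : ℝ) * ‖θ - m‖ * √b₀ := h4
      _ ≤ √(n : ℝ) * ‖θ - m‖ * √b := by gcongr
      _ = √(b * n) * ‖θ - m‖ := by rw [Real.sqrt_mul (hb₀.le.trans hb)]; ring
  have hmain := lintegral_tsub_le_of_proportional (c := c * I) (κ := κ) hgm hg1
    (measurableSet_localBall n θs R) hκ0 (ne_top_of_le_ne_top (by simp) hκ2)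
    (fun θ hθ => (hfg θ hθ).trans (le_of_eq (by rw [hker]; ring)))
    (fun θ hθ => le_trans (le_of_eq (by rw [hker]; ring)) (hgf θ hθ))
  refine hmain.trans ?_
  gcongr
  exact localBall_mono (by linarith)

end Local

/-! ### The posterior density: measurability, normalization, local form. -/

section Posterior

variable {p : ℕ} {𝒳 : Type*}

/-- The Lebesgue density of the weighted M-posterior. -/
def postDensity (Θ : Set (EuclideanSpace ℝ (Fin p))) (ρ : 𝒳 → EuclideanSpace ℝ (Fin p) → ℝ)
    (prior : EuclideanSpace ℝ (Fin p) → ℝ) {n : ℕ} (a : Fin n → ℝ) (x : Fin n → 𝒳) :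
    EuclideanSpace ℝ (Fin p) → ℝ≥0∞ :=
  Θ.indicator fun θ =>
    ENNReal.ofReal (posteriorWeight ρ prior a x θ / ∫ θ' in Θ, posteriorWeight ρ prior a x θ')

lemma posterior_eq_withDensity {Θ : Set (EuclideanSpace ℝ (Fin p))} (hΘ : MeasurableSet Θ)
    (ρ : 𝒳 → EuclideanSpace ℝ (Fin p) → ℝ) (prior : EuclideanSpace ℝ (Fin p) → ℝ) {n : ℕ}
    (a : Fin n → ℝ) (x : Fin n → 𝒳) :
    posterior Θ ρ prior a x = volume.withDensity (postDensity Θ ρ prior a x) := by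
  rw [posterior, postDensity, withDensity_indicator hΘ]

lemma mul_empiricalMean {n : ℕ} (a : Fin n → ℝ) (x : Fin n → 𝒳) (g : 𝒳 → ℝ) :
    (n : ℝ) * empiricalMean a x g = ∑ i, a i * g (x i) := by
  rcases Nat.eq_zero_or_pos n with rfl | hn
  · simp
  · have : (n : ℝ) ≠ 0 := by positivity
    simp [empiricalMean, this]

section Measurability

variable [MeasurableSpace 𝒳] {ρ : 𝒳 → EuclideanSpace ℝ (Fin p) → ℝ}
  {prior : EuclideanSpace ℝ (Fin p) → ℝ}

lemma measurable_posteriorWeight (hρm : Measurable (Function.uncurry ρ)) (hprior : Measurable prior)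
    (n : ℕ) : Measurable fun z : ((Fin n → 𝒳) × (Fin n → ℝ)) × EuclideanSpace ℝ (Fin p) =>
      posteriorWeight ρ prior z.1.2 z.1.1 z.2 := by
  unfold posteriorWeight
  simp_rw [mul_empiricalMean]
  have h (i : Fin n) : Measurable fun z : ((Fin n → 𝒳) × (Fin n → ℝ)) ×
      EuclideanSpace ℝ (Fin p) => ρ (z.1.1 i) z.2 :=
    hρm.comp (f := fun z : ((Fin n → 𝒳) × (Fin n → ℝ)) × EuclideanSpace ℝ (Fin p) =>
      (z.1.1 i, z.2)) (by fun_prop)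
  fun_prop

lemma measurable_postDensity {Θ : Set (EuclideanSpace ℝ (Fin p))} (hΘ : MeasurableSet Θ)
    (hρm : Measurable (Function.uncurry ρ)) (hprior : Measurable prior) (n : ℕ) :
    Measurable fun z : ((Fin n → 𝒳) × (Fin n → ℝ)) × EuclideanSpace ℝ (Fin p) =>
      postDensity Θ ρ prior z.1.2 z.1.1 z.2 := by
  have hw := measurable_posteriorWeight hρm hprior n
  have hZ : Measurable fun z : (Fin n → 𝒳) × (Fin n → ℝ) =>
      ∫ θ' in Θ, posteriorWeight ρ prior z.2 z.1 θ' :=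
    (hw.stronglyMeasurable.integral_prod_right' (ν := volume.restrict Θ)).measurable
  have h : Measurable fun z : ((Fin n → 𝒳) × (Fin n → ℝ)) × EuclideanSpace ℝ (Fin p) =>
      ENNReal.ofReal (posteriorWeight ρ prior z.1.2 z.1.1 z.2 /
        ∫ θ' in Θ, posteriorWeight ρ prior z.1.2 z.1.1 θ') :=
    (hw.div (hZ.comp measurable_fst)).ennreal_ofReal
  exact h.indicator (measurable_snd hΘ)

lemma measurable_posterior_apply {Θ : Set (EuclideanSpace ℝ (Fin p))} (hΘ : MeasurableSet Θ)
    (hρm : Measurable (Function.uncurry ρ)) (hprior : Measurable prior) {n : ℕ} (a : Fin n → ℝ)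
    {A : Set (EuclideanSpace ℝ (Fin p))} (hA : MeasurableSet A) :
    Measurable fun x => posterior Θ ρ prior a x A := by
  simp_rw [posterior_eq_withDensity hΘ, withDensity_apply _ hA]
  exact Measurable.lintegral_prod_right' (f := fun z => postDensity Θ ρ prior a z.1 z.2)
    ((measurable_postDensity hΘ hρm hprior n).comp
      (g := fun z : ((Fin n → 𝒳) × (Fin n → ℝ)) × EuclideanSpace ℝ (Fin p) => _)
      (f := fun z : (Fin n → 𝒳) × EuclideanSpace ℝ (Fin p) => ((z.1, a), z.2)) (by fun_prop))

/-- The mass by which the approximating Gaussian density exceeds the posterior density. -/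
def gaussExcess (Θ : Set (EuclideanSpace ℝ (Fin p))) (ρ : 𝒳 → EuclideanSpace ℝ (Fin p) → ℝ)
    (prior : EuclideanSpace ℝ (Fin p) → ℝ)
    (θhat : ∀ n : ℕ, (Fin n → ℝ) → (Fin n → 𝒳) → EuclideanSpace ℝ (Fin p))
    (V : Matrix (Fin p) (Fin p) ℝ) {n : ℕ} (a : Fin n → ℝ) (x : Fin n → 𝒳) : ℝ≥0∞ :=
  ∫⁻ θ, (gaussDensity V (avgWeight a * n) (θhat n a x) θ - postDensity Θ ρ prior a x θ)

/-- Joint measurability in data and weights is what lets Tonelli apply. This is why the excess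
replaces `dTV`, a supremum over a possibly uncountable family of sets. -/
lemma measurable_gaussExcess {Θ : Set (EuclideanSpace ℝ (Fin p))} (hΘ : MeasurableSet Θ)
    (hρm : Measurable (Function.uncurry ρ)) (hprior : Measurable prior)
    {θhat : ∀ n : ℕ, (Fin n → ℝ) → (Fin n → 𝒳) → EuclideanSpace ℝ (Fin p)}
    (hθhat : ∀ n, Measurable (Function.uncurry (θhat n))) (V : Matrix (Fin p) (Fin p) ℝ) (n : ℕ) :
    Measurable fun z : (Fin n → 𝒳) × (Fin n → ℝ) =>
      gaussExcess Θ ρ prior θhat V z.2 z.1 := by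
  have hm : Measurable fun z : (Fin n → 𝒳) × (Fin n → ℝ) => θhat n z.2 z.1 :=
    (hθhat n).comp measurable_swap
  have ha : Measurable fun z : (Fin n → 𝒳) × (Fin n → ℝ) => avgWeight z.2 * (n : ℝ) := by
    unfold avgWeight
    fun_prop
  have hk : Measurable fun z : ((Fin n → 𝒳) × (Fin n → ℝ)) × EuclideanSpace ℝ (Fin p) =>
      ENNReal.ofReal (gaussKernel V (avgWeight z.1.2 * n) (θhat n z.1.2 z.1.1) z.2) := by
    unfold gaussKernel
    have hm' : Measurable fun z : ((Fin n → 𝒳) × (Fin n → ℝ)) × EuclideanSpace ℝ (Fin p) =>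
      θhat n z.1.2 z.1.1 := hm.comp measurable_fst
    have ha' : Measurable fun z : ((Fin n → 𝒳) × (Fin n → ℝ)) × EuclideanSpace ℝ (Fin p) =>
      avgWeight z.1.2 * (n : ℝ) := ha.comp measurable_fst
    fun_prop
  have hg : Measurable fun z : ((Fin n → 𝒳) × (Fin n → ℝ)) × EuclideanSpace ℝ (Fin p) =>
      gaussDensity V (avgWeight z.1.2 * n) (θhat n z.1.2 z.1.1) z.2 :=
    hk.div (hk.lintegral_prod_right'.comp measurable_fst)
  exact (hg.sub (measurable_postDensity hΘ hρm hprior n)).lintegral_prod_right'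

end Measurability

/-- The weighted M-posterior is a probability distribution. -/
lemma lintegral_postDensity [MeasurableSpace 𝒳] {Θ : Set (EuclideanSpace ℝ (Fin p))}
    (hΘ : MeasurableSet Θ) {ρ : 𝒳 → EuclideanSpace ℝ (Fin p) → ℝ}
    (hρm : Measurable (Function.uncurry ρ)) (hρ0 : ∀ x, ∀ θ ∈ Θ, 0 ≤ ρ x θ)
    {prior : EuclideanSpace ℝ (Fin p) → ℝ} (hprior : Measurable prior)
    (hprior0 : ∀ θ ∈ Θ, 0 ≤ prior θ) (hprior1 : ∫ θ in Θ, prior θ = 1)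
    {n : ℕ} {a : Fin n → ℝ} (ha : ∀ i, 0 < a i) (x : Fin n → 𝒳) :
    0 < ∫ θ in Θ, posteriorWeight ρ prior a x θ ∧ ∫⁻ θ, postDensity Θ ρ prior a x θ = 1 := by
  have hwm : Measurable (posteriorWeight ρ prior a x) :=
    (measurable_posteriorWeight hρm hprior n).comp
      (g := fun z : ((Fin n → 𝒳) × (Fin n → ℝ)) × EuclideanSpace ℝ (Fin p) => _)
      (f := fun θ : EuclideanSpace ℝ (Fin p) => ((x, a), θ)) (by fun_prop)
  -- The Bochner integral of a non-integrable function is 0, not 1.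
  have hpint : IntegrableOn prior Θ := by
    by_contra h
    rw [integral_undef h] at hprior1
    exact zero_ne_one hprior1
  have hw0 : ∀ θ ∈ Θ, 0 ≤ posteriorWeight ρ prior a x θ := fun θ hθ =>
    mul_nonneg (Real.exp_pos _).le (hprior0 θ hθ)
  have hwle : ∀ θ ∈ Θ, posteriorWeight ρ prior a x θ ≤ prior θ := by
    intro θ hθ
    rw [posteriorWeight, mul_empiricalMean]
    refine mul_le_of_le_one_left (hprior0 θ hθ) (Real.exp_le_one_iff.2 (neg_nonpos.2 ?_))
    exact Finset.sum_nonneg fun i _ => mul_nonneg (ha i).le (hρ0 _ _ hθ)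
  have hwint : IntegrableOn (posteriorWeight ρ prior a x) Θ := by
    refine hpint.mono' hwm.aestronglyMeasurable ((ae_restrict_iff' hΘ).2
      (Eventually.of_forall fun θ hθ => ?_))
    rw [Real.norm_of_nonneg (hw0 θ hθ)]
    exact hwle θ hθ
  have hw0ae : 0 ≤ᵐ[volume.restrict Θ] posteriorWeight ρ prior a x :=
    (ae_restrict_iff' hΘ).2 (Eventually.of_forall hw0)
  have hZ : 0 < ∫ θ in Θ, posteriorWeight ρ prior a x θ := by
    refine lt_of_le_of_ne (integral_nonneg_of_ae hw0ae) fun h => ?_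
    rw [eq_comm, integral_eq_zero_iff_of_nonneg_ae hw0ae hwint] at h
    have : prior =ᵐ[volume.restrict Θ] 0 := by
      filter_upwards [h] with θ hθ
      exact (mul_eq_zero.1 hθ).resolve_left (Real.exp_pos _).ne'
    rw [integral_congr_ae this] at hprior1
    simp at hprior1
  refine ⟨hZ, ?_⟩
  unfold postDensity
  rw [lintegral_indicator hΘ, ← ofReal_integral_eq_lintegral_ofReal (hwint.div_const _)
    (hw0ae.mono fun θ hθ => div_nonneg hθ hZ.le), integral_div, div_self hZ.ne', ENNReal.ofReal_one]

/-- The exact form of the posterior weight in terms of the LAN remainder. -/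
lemma posteriorWeight_eq {V : Matrix (Fin p) (Fin p) ℝ} (hV : V.PosDef)
    (ρ : 𝒳 → EuclideanSpace ℝ (Fin p) → ℝ) (prior : EuclideanSpace ℝ (Fin p) → ℝ)
    (θhat : ∀ n : ℕ, (Fin n → ℝ) → (Fin n → 𝒳) → EuclideanSpace ℝ (Fin p))
    (θs : EuclideanSpace ℝ (Fin p)) {n : ℕ} (hn : 0 < n) (a : Fin n → ℝ) (x : Fin n → 𝒳) :
    ∃ A : ℝ, 0 < A ∧ ∀ θ, posteriorWeight ρ prior a x θ =
      A * Real.exp (lanRemainder ρ θhat θs V a x (√(n : ℝ) • (θ - θs))) *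
        gaussKernel V (avgWeight a * n) (θhat n a x) θ * prior θ := by
  have hs0 : 0 < √(n : ℝ) := Real.sqrt_pos.2 (by exact_mod_cast hn)
  set W := toEuclideanCLM (𝕜 := ℝ) V with hW
  set k := √(n : ℝ) • (θhat n a x - θs) with hk
  -- `A` collects what does not depend on `θ`: the loss at `θs` and the term completing the square.
  refine ⟨Real.exp (-∑ i, a i * ρ (x i) θs + avgWeight a / 2 * inner ℝ k (W k)),
    Real.exp_pos _, fun θ => ?_⟩
  set h := √(n : ℝ) • (θ - θs) with hh
  have hθ : θs + (√(n : ℝ))⁻¹ • h = θ := by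
    rw [hh, inv_smul_smul₀ hs0.ne']
    abel
  rw [posteriorWeight, mul_empiricalMean, gaussKernel_local V _ n θs, ← hk, ← hh, ← Real.exp_add,
    ← Real.exp_add]
  congr 2
  have hk' : WithLp.toLp 2 (√(n : ℝ) • ((θhat n a x).ofLp - θs.ofLp)) = k := rfl
  rw [lanRemainder, hθ, ← inner_toEuclideanCLM, ← inner_toEuclideanCLM, hk', ← hW]
  have hc : inner ℝ k (W h) = inner ℝ h (W k) := inner_toEuclideanCLM_comm hV k h
  simp only [map_sub, inner_sub_left, inner_sub_right, hc, mul_sub, Finset.sum_sub_distrib]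
  ring

/-- Where the LAN remainder is small and the prior is nearly constant, the posterior density is
nearly proportional to the Gaussian kernel. -/
lemma exists_postDensity_proportional {V : Matrix (Fin p) (Fin p) ℝ} (hV : V.PosDef)
    {Θ : Set (EuclideanSpace ℝ (Fin p))} {ρ : 𝒳 → EuclideanSpace ℝ (Fin p) → ℝ}
    {prior : EuclideanSpace ℝ (Fin p) → ℝ}
    {θhat : ∀ n : ℕ, (Fin n → ℝ) → (Fin n → 𝒳) → EuclideanSpace ℝ (Fin p)}
    {θs : EuclideanSpace ℝ (Fin p)} {n : ℕ} (hn : 0 < n) {a : Fin n → ℝ} {x : Fin n → 𝒳}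
    (hZ : 0 < ∫ θ in Θ, posteriorWeight ρ prior a x θ) {η π₀ R : ℝ} (hπ₀ : 0 < π₀)
    (hΘ : localBall n θs R ⊆ Θ)
    (hprior : ∀ θ ∈ localBall n θs R,
      prior θ ≤ Real.exp η * π₀ ∧ π₀ ≤ Real.exp η * prior θ)
    (hR : ∀ h, ‖h‖ ≤ R → |lanRemainder ρ θhat θs V a x h| ≤ η) :
    ∃ c : ℝ≥0∞, ∀ θ ∈ localBall n θs R,
      postDensity Θ ρ prior a x θ ≤ c * ENNReal.ofReal (Real.exp (2 * η)) *
        ENNReal.ofReal (gaussKernel V (avgWeight a * n) (θhat n a x) θ) ∧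
      c * ENNReal.ofReal (gaussKernel V (avgWeight a * n) (θhat n a x) θ) ≤
        ENNReal.ofReal (Real.exp (2 * η)) * postDensity Θ ρ prior a x θ := by
  obtain ⟨A, hA, hw⟩ := posteriorWeight_eq hV ρ prior θhat θs hn a x
  set Z := ∫ θ in Θ, posteriorWeight ρ prior a x θ with hZdef
  -- The remainder and the prior each cost a factor `exp η`, whence `exp (2 * η)`.
  refine ⟨ENNReal.ofReal (A * π₀ / Z), fun θ hθ => ?_⟩
  obtain ⟨hp1, hp2⟩ := hprior θ hθ
  obtain ⟨hr1, hr2⟩ := abs_le.1 (hR _ hθ)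
  have hk := gaussKernel_pos V (avgWeight a * n) (θhat n a x) θ
  set k := gaussKernel V (avgWeight a * n) (θhat n a x) θ with hkdef
  set r := lanRemainder ρ θhat θs V a x (√(n : ℝ) • (θ - θs)) with hrdef
  have hp0 : 0 ≤ prior θ := by
    have : 0 < Real.exp η * prior θ := hπ₀.trans_le hp2
    exact (pos_of_mul_pos_right this (Real.exp_pos _).le).le
  have h2 : Real.exp (2 * η) = Real.exp η * Real.exp η := by rw [← Real.exp_add]; ring_nf
  rw [postDensity, Set.indicator_of_mem (hΘ hθ), hw, ← ENNReal.ofReal_mul (by positivity),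
    ← ENNReal.ofReal_mul (by positivity), ← ENNReal.ofReal_mul (by positivity),
    ← ENNReal.ofReal_mul (by positivity), ← hZdef, ← hkdef, ← hrdef, h2]
  constructor
  · refine ENNReal.ofReal_le_ofReal ?_
    calc A * Real.exp r * k * prior θ / Z ≤ A * Real.exp η * k * (Real.exp η * π₀) / Z := by
          gcongr
      _ = _ := by ring
  · refine ENNReal.ofReal_le_ofReal ?_
    have h1 : 1 ≤ Real.exp η * Real.exp r := by
      rw [← Real.exp_add, Real.one_le_exp_iff]
      linarith
    calc A * π₀ / Z * k ≤ A * (Real.exp η * prior θ) / Z * k * (Real.exp η * Real.exp r) := by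
          refine le_trans ?_ (le_mul_of_one_le_right (by positivity) h1)
          gcongr
      _ = _ := by ring

end Posterior

/-! ### Convergence for a fixed weight sequence. -/

section FixedWeights

/-- A family which vanishes along every radius sequence tending to infinity is small at a fixed
radius. -/
lemma exists_radius_of_tendsto {Φ : ℕ → ℝ → ℝ≥0∞}
    (h : ∀ r : ℕ → ℝ, Tendsto r atTop atTop → Tendsto (fun n => Φ n (r n)) atTop (𝓝 0))
    {τ : ℝ≥0∞} (hτ : 0 < τ) : ∃ M : ℝ, 0 ≤ M ∧ ∀ᶠ n in atTop, Φ n M ≤ τ := by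
  by_contra! hcon
  have hfreq (k : ℕ) : ∃ᶠ n in atTop, τ < Φ n k := hcon k k.cast_nonneg
  obtain ⟨φ, hφ, hφτ⟩ := extraction_forall_of_frequently hfreq
  -- The sequence equals `k` at the bad index `φ k` and `n` elsewhere; as `φ` increases strictly, it
  -- tends to infinity while failing along `φ`.
  set r : ℕ → ℝ := Function.extend φ (fun k => (k : ℝ)) (fun n => (n : ℝ)) with hr
  have hrφ (k : ℕ) : r (φ k) = k := hφ.injective.extend_apply _ _ k
  have hrlim : Tendsto r atTop atTop := by
    refine tendsto_atTop.2 fun b => ?_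
    obtain ⟨N, hN⟩ := exists_nat_ge b
    filter_upwards [eventually_ge_atTop (φ N)] with n hn
    refine hN.trans ?_
    by_cases hex : ∃ k, φ k = n
    · obtain ⟨k, rfl⟩ := hex
      rw [hrφ]
      exact_mod_cast hφ.le_iff_le.1 hn
    · rw [hr, Function.extend_apply' _ _ _ hex]
      exact_mod_cast (hφ.id_le N).trans hn
  have hlim := (h r hrlim).comp hφ.tendsto_atTop
  obtain ⟨k, hk⟩ := (hlim.eventually_lt_const hτ).exists
  simp only [Function.comp_apply, hrφ] at hk
  exact lt_asymm hk (hφτ k)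

variable {p : ℕ} {𝒳 : Type*} [MeasurableSpace 𝒳]

/-- Local balls shrink into every neighbourhood of their center. -/
lemma eventually_localBall_subset {U : Set (EuclideanSpace ℝ (Fin p))}
    {θs : EuclideanSpace ℝ (Fin p)} (hU : U ∈ 𝓝 θs) (R : ℝ) :
    ∀ᶠ n : ℕ in atTop, localBall n θs R ⊆ U := by
  obtain ⟨r, hr, hrU⟩ := Metric.mem_nhds_iff.1 hU
  have hlim : Tendsto (fun n : ℕ => √(n : ℝ) * r) atTop atTop :=
    (Real.tendsto_sqrt_atTop.comp tendsto_natCast_atTop_atTop).atTop_mul_const hr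
  filter_upwards [hlim.eventually_gt_atTop R, eventually_gt_atTop 0] with n hn hn0 θ hθ
  refine hrU (mem_ball_iff_norm.2 ?_)
  have hs0 : 0 < √(n : ℝ) := Real.sqrt_pos.2 (by exact_mod_cast hn0)
  have h1 : ‖√(n : ℝ) • (θ - θs)‖ ≤ R := hθ
  rw [norm_smul, Real.norm_of_nonneg hs0.le] at h1
  exact lt_of_mul_lt_mul_left (h1.trans_lt hn) hs0.le

/-- A function which is continuous and positive at `θs` is nearly constant around `θs`. -/
lemma eventually_le_exp_mul {prior : EuclideanSpace ℝ (Fin p) → ℝ} {θs : EuclideanSpace ℝ (Fin p)}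
    (hc : ContinuousAt prior θs) (h0 : 0 < prior θs) {η : ℝ} (hη : 0 < η) :
    ∀ᶠ θ in 𝓝 θs, prior θ ≤ Real.exp η * prior θs ∧ prior θs ≤ Real.exp η * prior θ := by
  have h1 : prior θs < Real.exp η * prior θs :=
    lt_mul_of_one_lt_left h0 (Real.one_lt_exp_iff.2 hη)
  have hc' : ContinuousAt (fun θ => Real.exp η * prior θ) θs := hc.const_mul _
  filter_upwards [hc.eventually_lt_const h1, hc'.eventually_const_lt h1] with θ h2 h3
  exact ⟨h2.le, h3.le⟩

/-- For a fixed weight sequence the posterior approaches the Gaussian in probability. -/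
lemma tendsto_gaussExcess {Q : Measure 𝒳} [IsProbabilityMeasure Q]
    {Θ : Set (EuclideanSpace ℝ (Fin p))} (hΘ : MeasurableSet Θ)
    {θs : EuclideanSpace ℝ (Fin p)} (hθs : θs ∈ interior Θ)
    {ρ : 𝒳 → EuclideanSpace ℝ (Fin p) → ℝ} (hρm : Measurable (Function.uncurry ρ))
    (hρ0 : ∀ x, ∀ θ ∈ Θ, 0 ≤ ρ x θ)
    {prior : EuclideanSpace ℝ (Fin p) → ℝ} (hprior : Measurable prior)
    (hprior0 : ∀ θ ∈ Θ, 0 ≤ prior θ) (hprior1 : ∫ θ in Θ, prior θ = 1)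
    (hpc : ContinuousAt prior θs) (hpos : 0 < prior θs)
    {θhat : ∀ n : ℕ, (Fin n → ℝ) → (Fin n → 𝒳) → EuclideanSpace ℝ (Fin p)}
    {V : Matrix (Fin p) (Fin p) ℝ} (hV : V.PosDef)
    {α : ℕ → ℝ} (hα : ∀ i, 0 < α i) {b₀ : ℝ} (hb₀ : 0 < b₀)
    (havg : ∀ᶠ n in atTop, b₀ ≤ avgWeight (firstTerms α n))
    (hLAN : WeightedMLAN Q ρ θhat θs V α) (hconc : Concentrates Q Θ ρ prior θs α)
    {ε : ℝ≥0∞} (hε : 0 < ε) :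
    Tendsto (fun n => iidLaw Q n {x | ε ≤ gaussExcess Θ ρ prior θhat V (firstTerms α n) x})
      atTop (𝓝 0) := by
  obtain ⟨e, he0, he1, heε⟩ : ∃ e : ℝ, 0 < e ∧ e ≤ 1 ∧ ENNReal.ofReal e ≤ ε := by
    have hm0 : min ε 1 ≠ 0 := (lt_min hε one_pos).ne'
    have hmt : min ε 1 ≠ ∞ := ne_top_of_le_ne_top (by simp) (min_le_right ε 1)
    refine ⟨(min ε 1).toReal, ENNReal.toReal_pos hm0 hmt, ?_, ?_⟩
    · simpa using ENNReal.toReal_mono (by simp) (min_le_right ε 1)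
    · rw [ENNReal.ofReal_toReal hmt]
      exact min_le_left _ _
  rw [ENNReal.tendsto_nhds_zero]
  intro τ hτ
  -- Here `κ = exp (2 η)` and `4 η = δ`, so `κ² = exp δ`. Gaussian tail, posterior tail and `κ²`
  -- cost `δ` each, and `3 δ < e`.
  set δ := e / 8 with hδ
  set η := e / 32 with hη
  have hδ0 : 0 < δ := by positivity
  have hη0 : 0 < η := by positivity
  have hτ2 : 0 < τ / 2 := ENNReal.half_pos hτ.ne'
  obtain ⟨M, hM, hMconc⟩ := exists_radius_of_tendsto (Φ := fun n r =>
    ∫⁻ x, posterior Θ ρ prior (firstTerms α n) x {θ | r < ‖√(n : ℝ) • (θ - θs)‖} ∂(iidLaw Q n))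
    hconc (τ := τ / 2 * ENNReal.ofReal δ)
    (ENNReal.mul_pos hτ2.ne' (ENNReal.ofReal_pos.2 hδ0).ne')
  obtain ⟨R, hMR, hRmain⟩ := exists_radius_lintegral_tsub_le hV hb₀ hM (ENNReal.ofReal_pos.2 hδ0)
  have hR0 : 0 ≤ R := by linarith
  have hLANR := ENNReal.tendsto_nhds_zero.1
    (hLAN (Metric.closedBall 0 R) (isCompact_closedBall _ _) (ENNReal.ofReal η)
      (ENNReal.ofReal_pos.2 hη0)) _ hτ2
  have hball := eventually_localBall_subset
    ((eventually_le_exp_mul hpc hpos hη0).and (mem_interior_iff_mem_nhds.1 hθs)) R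
  filter_upwards [hMconc, hLANR, hball, havg, eventually_gt_atTop 0] with n h1 h2 h3 h4 hn
  have hmeasM : MeasurableSet {θ : EuclideanSpace ℝ (Fin p) | M < ‖√(n : ℝ) • (θ - θs)‖} :=
    measurableSet_lt measurable_const (by fun_prop)
  have hMarkov : iidLaw Q n {x | ENNReal.ofReal δ ≤ posterior Θ ρ prior (firstTerms α n) x
      {θ | M < ‖√(n : ℝ) • (θ - θs)‖}} ≤ τ / 2 := by
    refine (meas_ge_le_lintegral_div
      (measurable_posterior_apply hΘ hρm hprior _ hmeasM).aemeasurable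
      (ENNReal.ofReal_pos.2 hδ0).ne' ENNReal.ofReal_ne_top).trans ?_
    exact ENNReal.div_le_of_le_mul h1
  refine le_trans (measure_mono ?_) ((measure_union_le _ _).trans
    ((add_le_add hMarkov h2).trans (ENNReal.add_halves τ).le))
  -- Outside the two bad events, a heavy posterior tail and a large remainder, the argument is
  -- deterministic.
  intro x hx
  by_contra hnot
  rw [Set.mem_union, not_or] at hnot
  obtain ⟨hn1, hn2⟩ := hnot
  have hn1 : posterior Θ ρ prior (firstTerms α n) x {θ | M < ‖√(n : ℝ) • (θ - θs)‖} <
    ENNReal.ofReal δ := not_le.1 hn1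
  have hn2 : ⨆ h ∈ Metric.closedBall (0 : EuclideanSpace ℝ (Fin p)) R,
    ENNReal.ofReal |lanRemainder ρ θhat θs V (firstTerms α n) x h| < ENNReal.ofReal η :=
    not_le.1 hn2
  have hrem (h : EuclideanSpace ℝ (Fin p)) (hh : ‖h‖ ≤ R) :
      |lanRemainder ρ θhat θs V (firstTerms α n) x h| ≤ η := by
    refine (ENNReal.ofReal_le_ofReal_iff hη0.le).1 (le_trans ?_ hn2.le)
    exact le_iSup₂ (f := fun h _ => ENNReal.ofReal |lanRemainder ρ θhat θs V (firstTerms α n) x h|)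
      h (mem_closedBall_zero_iff.2 hh)
  obtain ⟨hZ, hf1⟩ := lintegral_postDensity hΘ hρm hρ0 hprior hprior0 hprior1
    (a := firstTerms α n) (fun i => hα i) x
  obtain ⟨c, hc⟩ := exists_postDensity_proportional hV hn hZ hpos
    (fun θ hθ => (h3 hθ).2) (fun θ hθ => (h3 hθ).1) hrem
  set f := postDensity Θ ρ prior (firstTerms α n) x with hf
  have hfm : Measurable f := (measurable_postDensity hΘ hρm hprior n).comp
    (g := fun z : ((Fin n → 𝒳) × (Fin n → ℝ)) × EuclideanSpace ℝ (Fin p) => _)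
    (f := fun θ : EuclideanSpace ℝ (Fin p) => ((x, firstTerms α n), θ)) (by fun_prop)
  have hcompl : (localBall n θs M)ᶜ = {θ | M < ‖√(n : ℝ) • (θ - θs)‖} := by
    ext θ
    exact not_le (α := ℝ)
  have hmass : ENNReal.ofReal (1 - δ) ≤ ∫⁻ θ in localBall n θs M, f θ := by
    rw [posterior_eq_withDensity hΘ, withDensity_apply _ hmeasM, ← hcompl] at hn1
    have hsum := lintegral_add_compl f (measurableSet_localBall n θs M) (μ := volume)
    rw [ENNReal.ofReal_sub _ hδ0.le, ENNReal.ofReal_one, tsub_le_iff_right, ← hf1, ← hsum]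
    gcongr
  have hexp : Real.exp (2 * η) ≤ 2 := by
    have h5 := Real.add_one_le_exp (-(2 * η))
    rw [Real.exp_neg] at h5
    have h6 : (2 : ℝ)⁻¹ ≤ (Real.exp (2 * η))⁻¹ := le_trans (by linarith) h5
    exact (inv_le_inv₀ (by norm_num) (Real.exp_pos _)).1 h6
  have hfin := hRmain n hn _ h4 θs (θhat n (firstTerms α n) x) f hfm hf1 c
    (ENNReal.ofReal (Real.exp (2 * η))) (ENNReal.ofReal_pos.2 (Real.exp_pos _)).ne'
    (by simpa using ENNReal.ofReal_le_ofReal hexp) (fun θ hθ => (hc θ hθ).1)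
    (fun θ hθ => (hc θ hθ).2) (by
      refine le_trans ?_ hmass
      rw [show (2⁻¹ : ℝ≥0∞) = ENNReal.ofReal 2⁻¹ by
        rw [ENNReal.ofReal_inv_of_pos (by norm_num)]; simp]
      exact ENNReal.ofReal_le_ofReal (by linarith))
  -- `(1 - δ) exp (-δ) ≥ (1 - δ)² ≥ 1 - 2 δ`.
  have hq : ENNReal.ofReal (1 - 2 * δ) ≤
      (∫⁻ θ in localBall n θs M, f θ) / ENNReal.ofReal (Real.exp (2 * η)) ^ 2 := by
    rw [ENNReal.le_div_iff_mul_le (by simp [Real.exp_pos]) (by simp),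
      ← ENNReal.ofReal_pow (Real.exp_pos _).le, ← ENNReal.ofReal_mul (by linarith)]
    refine le_trans (ENNReal.ofReal_le_ofReal ?_) hmass
    have h5 := Real.add_one_le_exp (-δ)
    have h6 : Real.exp (2 * η) ^ 2 = Real.exp δ := by
      rw [← Real.exp_nat_mul]
      congr 1
      rw [hη, hδ]
      push_cast
      ring
    have h7 : Real.exp (-δ) * Real.exp δ = 1 := by rw [← Real.exp_add]; simp
    rw [h6]
    have h8 : (1 - δ) * Real.exp δ ≤ 1 := by
      rw [← h7]
      gcongr
      linarith
    calc (1 - 2 * δ) * Real.exp δ ≤ (1 - δ) * ((1 - δ) * Real.exp δ) := by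
          nlinarith [sq_nonneg δ, Real.exp_pos δ, mul_nonneg (sq_nonneg δ) (Real.exp_pos δ).le]
      _ ≤ (1 - δ) * 1 := by
          gcongr
          linarith
      _ = 1 - δ := mul_one _
  have hlt : gaussExcess Θ ρ prior θhat V (firstTerms α n) x < ε := by
    calc gaussExcess Θ ρ prior θhat V (firstTerms α n) x
        ≤ ENNReal.ofReal δ + (1 - ENNReal.ofReal (1 - 2 * δ)) := by
          refine hfin.trans ?_
          gcongr
      _ = ENNReal.ofReal (3 * δ) := by
          rw [← ENNReal.ofReal_one, ← ENNReal.ofReal_sub _ (by linarith),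
            ← ENNReal.ofReal_add hδ0.le (by linarith)]
          congr 1
          ring
      _ < ENNReal.ofReal e := (ENNReal.ofReal_lt_ofReal_iff he0).2 (by linarith)
      _ ≤ ε := heε
  exact not_le.2 hlt hx

end FixedWeights

/-! ### Random weights: strong law and integration over the weights. -/

section RandomWeights

lemma avgWeight_firstTerms (α : ℕ → ℝ) (n : ℕ) :
    avgWeight (firstTerms α n) = (∑ i ∈ Finset.range n, α i) / n := by
  rw [avgWeight, Finset.sum_range, div_eq_inv_mul]
  rfl

/-- The strong law of large numbers for the coordinates of an infinite product measure. -/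
lemma ae_tendsto_average_infinitePi (π : Measure ℝ) [IsProbabilityMeasure π] {g : ℝ → ℝ}
    (hg : Measurable g) (hgi : Integrable g π) :
    ∀ᵐ α ∂(Measure.infinitePi fun _ : ℕ => π),
      Tendsto (fun n : ℕ => (∑ i ∈ Finset.range n, g (α i)) / n) atTop (𝓝 (∫ a, g a ∂π)) := by
  have hmp (i : ℕ) := measurePreserving_eval_infinitePi (fun _ : ℕ => π) i
  have hmean : ∫ α, g (α 0) ∂(Measure.infinitePi fun _ : ℕ => π) = ∫ a, g a ∂π := by
    have h := integral_map (μ := Measure.infinitePi fun _ : ℕ => π)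
      (hmp 0).measurable.aemeasurable (f := g) hg.aestronglyMeasurable
    rw [(hmp 0).map_eq] at h
    exact h.symm
  have h := strong_law_ae_real (μ := Measure.infinitePi fun _ : ℕ => π)
    (fun i (α : ℕ → ℝ) => g (α i)) ((hmp 0).integrable_comp_of_integrable hgi)
    (fun i j hij => (iIndepFun_infinitePi (P := fun _ : ℕ => π) fun _ => hg).indepFun hij)
    (fun i => ?_)
  · rwa [hmean] at h
  · refine IdentDistrib.comp (u := g) (f := fun α : ℕ → ℝ => α i) (g := fun α : ℕ → ℝ => α 0)
      ⟨(hmp i).measurable.aemeasurable, (hmp 0).measurable.aemeasurable, ?_⟩ hg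
    exact (hmp i).map_eq.trans (hmp 0).map_eq.symm

/-- Almost every sequence of i.i.d. positive weights is admissible. -/
lemma ae_weights {π : Measure ℝ} [IsProbabilityMeasure π] (hpos : ∀ᵐ a ∂π, 0 < a)
    (hmom : MemLp id 2 π) :
    ∃ b₀ : ℝ, 0 < b₀ ∧ ∀ᵐ α ∂(Measure.infinitePi fun _ : ℕ => π), (∀ i, 0 < α i) ∧
      FiniteSecondMoment α ∧ ∀ᶠ n in atTop, b₀ ≤ avgWeight (firstTerms α n) := by
  have hint : Integrable (fun a : ℝ => a) π := hmom.integrable (by norm_num)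
  have hint2 : Integrable (fun a : ℝ => a ^ 2) π := hmom.integrable_sq
  have hmean : 0 < ∫ a, a ∂π := by
    refine lt_of_le_of_ne (integral_nonneg_of_ae (hpos.mono fun a ha => ha.le)) fun h => ?_
    rw [eq_comm, integral_eq_zero_iff_of_nonneg_ae (hpos.mono fun a ha => ha.le) hint] at h
    obtain ⟨a, ha, ha'⟩ := (h.and hpos).exists
    exact ha'.ne' ha
  -- Half the mean is a deterministic bound that the averages eventually exceed.
  refine ⟨(∫ a, a ∂π) / 2, half_pos hmean, ?_⟩
  have hall : ∀ᵐ α ∂(Measure.infinitePi fun _ : ℕ => π), ∀ i, 0 < α i :=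
    ae_all_iff.2 fun i =>
      (measurePreserving_eval_infinitePi (fun _ : ℕ => π) i).quasiMeasurePreserving.ae hpos
  filter_upwards [hall, ae_tendsto_average_infinitePi π measurable_id hint,
    ae_tendsto_average_infinitePi π (g := fun a => a ^ 2) (by fun_prop) hint2] with α h1 h2 h3
  refine ⟨h1, ?_, ?_⟩
  · have : Tendsto (fun n : ℕ => ENNReal.ofReal ((n : ℝ)⁻¹ * ∑ i ∈ Finset.range n, α i ^ 2))
        atTop (𝓝 (ENNReal.ofReal (∫ a, a ^ 2 ∂π))) := by
      refine (ENNReal.continuous_ofReal.tendsto _).comp ?_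
      simpa only [div_eq_inv_mul] using h3
    rw [FiniteSecondMoment, this.limsup_eq]
    exact ENNReal.ofReal_lt_top
  · simp_rw [avgWeight_firstTerms]
    exact h2.eventually_const_le (half_lt_self hmean)

lemma measurable_firstTerms (n : ℕ) : Measurable fun α : ℕ → ℝ => firstTerms α n :=
  measurable_pi_lambda _ fun i => measurable_pi_apply (i : ℕ)

/-- This couples the weight laws for all `n` on one space, where almost sure statements make sense.
-/
lemma map_firstTerms_infinitePi (π : Measure ℝ) [IsProbabilityMeasure π] (n : ℕ) :
    (Measure.infinitePi fun _ : ℕ => π).map (fun α => firstTerms α n) = iidLaw π n := by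
  have h := Measure.map_infinitePi_infinitePi_of_inj (P := fun _ : ℕ => π)
    (f := fun i : Fin n => (i : ℕ)) Fin.val_injective
  rw [iidLaw, ← Measure.infinitePi_eq_pi, ← h]
  rfl

/-- Convergence in probability for almost every realization of the weights implies convergence
in probability jointly in the data and the weights. -/
lemma tendsto_prod_of_ae_tendsto {𝒳 : Type*} [MeasurableSpace 𝒳] {Q : Measure 𝒳}
    [IsProbabilityMeasure Q] {π : Measure ℝ} [IsProbabilityMeasure π]
    {S : ∀ n : ℕ, Set ((Fin n → 𝒳) × (Fin n → ℝ))} (hS : ∀ n, MeasurableSet (S n))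
    (h : ∀ᵐ α ∂(Measure.infinitePi fun _ : ℕ => π),
      Tendsto (fun n => iidLaw Q n {x | (x, firstTerms α n) ∈ S n}) atTop (𝓝 0)) :
    Tendsto (fun n => ((iidLaw Q n).prod (iidLaw π n)) (S n)) atTop (𝓝 0) := by
  have (n : ℕ) : IsProbabilityMeasure (iidLaw Q n) := by unfold iidLaw; infer_instance
  have (n : ℕ) : IsProbabilityMeasure (iidLaw π n) := by unfold iidLaw; infer_instance
  have hm (n : ℕ) : Measurable fun a => iidLaw Q n ((fun x => (x, a)) ⁻¹' S n) :=
    measurable_measure_prodMk_right (hS n)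
  have heq (n : ℕ) : ((iidLaw Q n).prod (iidLaw π n)) (S n) =
      ∫⁻ α, iidLaw Q n {x | (x, firstTerms α n) ∈ S n} ∂(Measure.infinitePi fun _ : ℕ => π) := by
    rw [Measure.prod_apply_symm (hS n), ← map_firstTerms_infinitePi π n,
      lintegral_map (hm n) (measurable_firstTerms n)]
    rfl
  simp_rw [heq]
  have := tendsto_lintegral_of_dominated_convergence (fun _ => 1)
    (μ := Measure.infinitePi fun _ : ℕ => π) (f := fun _ => 0)
    (F := fun n α => iidLaw Q n {x | (x, firstTerms α n) ∈ S n})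
    (fun n => (hm n).comp (measurable_firstTerms n))
    (fun n => Eventually.of_forall fun α => prob_le_one) (by simp) h
  simpa using this

end RandomWeights

end MPosterior

end

/-! ### The Bernstein–von Mises theorem. -/

theorem mainTheorem11 {p : ℕ} {𝒳 : Type*} [MeasurableSpace 𝒳]
    -- the statistical model, and the true parameter in the interior of the parameter space
    (Θ : Set (EuclideanSpace ℝ (Fin p))) (hΘ : MeasurableSet Θ)
    (P : Θ → Measure 𝒳) [∀ θ, IsProbabilityMeasure (P θ)]
    (θs : Θ) (hθs : (θs : EuclideanSpace ℝ (Fin p)) ∈ interior Θ)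
    -- the loss and its score
    (ρ : 𝒳 → EuclideanSpace ℝ (Fin p) → ℝ) (hρm : Measurable (Function.uncurry ρ))
    (hρ0 : ∀ x, ∀ θ ∈ Θ, 0 ≤ ρ x θ)
    (ψ : 𝒳 → EuclideanSpace ℝ (Fin p) → EuclideanSpace ℝ (Fin p))
    (hψ : MPosterior.IsScore Θ ρ ψ)
    -- the prior density
    (prior : EuclideanSpace ℝ (Fin p) → ℝ) (hprior_meas : Measurable prior)
    (hprior_nonneg : ∀ θ ∈ Θ, 0 ≤ prior θ) (hprior_one : ∫ θ in Θ, prior θ = 1)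
    (hprior_nhds : ∃ U ∈ 𝓝 (θs : EuclideanSpace ℝ (Fin p)),
      ContinuousOn prior U ∧ ∀ θ ∈ U, 0 < prior θ)
    -- the weighted M-estimator
    (θhat : ∀ n : ℕ, (Fin n → ℝ) → (Fin n → 𝒳) → EuclideanSpace ℝ (Fin p))
    (hθhat_meas : ∀ n, Measurable (Function.uncurry (θhat n)))
    (hθhat : MPosterior.IsWeightedMEstimator Θ ψ θhat)
    -- the distribution of the weights
    (πα : Measure ℝ) [IsProbabilityMeasure πα] (hπα_pos : ∀ᵐ a ∂πα, 0 < a)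
    (hπα_mom : MemLp id 2 πα)
    -- weighted M-LAN, with one matrix for all weight sequences
    (V : Matrix (Fin p) (Fin p) ℝ) (hV : V.PosDef)
    (hLAN : ∀ α : ℕ → ℝ, (∀ i, 0 < α i) → MPosterior.FiniteSecondMoment α →
      MPosterior.WeightedMLAN (P θs) ρ θhat θs V α)
    -- concentration, for almost every realization of the weights
    (hconc : ∀ᵐ α ∂(Measure.infinitePi fun _ : ℕ => πα),
      MPosterior.Concentrates (P θs) Θ ρ prior θs α) :
    MPosterior.TendstoZeroInProb
      (fun n => (MPosterior.iidLaw (P θs) n).prod (MPosterior.iidLaw πα n))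
      (fun n (xa : (Fin n → 𝒳) × (Fin n → ℝ)) =>
        MPosterior.dTV (MPosterior.posterior Θ ρ prior xa.2 xa.1)
          (multivariateGaussian (θhat n xa.2 xa.1)
            ((MPosterior.avgWeight xa.2 * (n : ℝ))⁻¹ • V⁻¹))) := by
  obtain ⟨b₀, hb₀, hweights⟩ := MPosterior.ae_weights hπα_pos hπα_mom
  obtain ⟨U, hU, hUc, hUpos⟩ := hprior_nhds
  intro ε hε
  have hmeas (n : ℕ) : MeasurableSet {z : (Fin n → 𝒳) × (Fin n → ℝ) |
      ε ≤ MPosterior.gaussExcess Θ ρ prior θhat V z.2 z.1} :=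
    measurableSet_le measurable_const
      (MPosterior.measurable_gaussExcess hΘ hρm hprior_meas hθhat_meas V n)
  have hexcess := MPosterior.tendsto_prod_of_ae_tendsto (Q := P θs) (π := πα) hmeas <| by
    filter_upwards [hweights, hconc] with α hα hcα
    exact MPosterior.tendsto_gaussExcess hΘ hθs hρm hρ0 hprior_meas hprior_nonneg hprior_one
      (hUc.continuousAt hU) (hUpos _ (mem_of_mem_nhds hU)) hV hα.1 hb₀ hα.2.2
      (hLAN α hα.1 hα.2.1) hcα hε
  refine tendsto_of_tendsto_of_tendsto_of_le_of_le' tendsto_const_nhds hexcess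
    (Eventually.of_forall fun _ => zero_le) ?_
  filter_upwards [eventually_gt_atTop 0] with n hn
  have hposw : ∀ᵐ z ∂((MPosterior.iidLaw (P θs) n).prod (MPosterior.iidLaw πα n)),
      ∀ i, 0 < z.2 i := by
    have : SigmaFinite (MPosterior.iidLaw πα n) := by unfold MPosterior.iidLaw; infer_instance
    refine Measure.quasiMeasurePreserving_snd.ae (p := fun a : Fin n → ℝ => ∀ i, 0 < a i)
      (ae_all_iff.2 fun i => ?_)
    exact (Measure.quasiMeasurePreserving_eval (μ := fun _ : Fin n => πα) i).ae hπα_pos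
  -- The inclusion of events holds only where all weights are positive, which makes the covariance
  -- scale positive (hence also `n > 0`). No measurability of the `dTV` event is needed.
  refine measure_mono_ae ?_
  filter_upwards [hposw] with z hz hle
  have hn' : (0 : ℝ) < n := by exact_mod_cast hn
  have : Nonempty (Fin n) := ⟨⟨0, hn⟩⟩
  have havg : 0 < MPosterior.avgWeight z.2 * (n : ℝ) :=
    mul_pos (mul_pos (inv_pos.2 hn') (Finset.sum_pos (fun i _ => hz i) Finset.univ_nonempty)) hn'
  obtain ⟨-, hf1⟩ := MPosterior.lintegral_postDensity hΘ hρm hρ0 hprior_meas hprior_nonneg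
    hprior_one hz z.1
  obtain ⟨hG, -, -⟩ := MPosterior.multivariateGaussian_eq_withDensity_gaussDensity hV havg
    (θhat n z.2 z.1)
  have hg1 : ∫⁻ θ, MPosterior.gaussDensity V (MPosterior.avgWeight z.2 * n) (θhat n z.2 z.1) θ
      = 1 := by
    rw [← setLIntegral_univ, ← withDensity_apply _ MeasurableSet.univ, ← hG, measure_univ]
  have hfm : Measurable (MPosterior.postDensity Θ ρ prior z.2 z.1) :=
    (MPosterior.measurable_postDensity hΘ hρm hprior_meas n).comp
      (g := fun z : ((Fin n → 𝒳) × (Fin n → ℝ)) × EuclideanSpace ℝ (Fin p) => _)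
      (f := fun θ : EuclideanSpace ℝ (Fin p) => (z, θ)) (by fun_prop)
  refine le_trans (show ε ≤ _ from hle) ?_
  rw [MPosterior.posterior_eq_withDensity hΘ, hG]
  exact MPosterior.dTV_withDensity_le hfm hf1 hg1
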